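/- **Model.** Fix $\lambda_B,\lambda_u,A_B,P_B,P_d,\beta,P_0,T>0$, $\alpha_B>2$, $\sigma_B\ge 0$, $\varepsilon\in(0,1]$, $\eta\ge 0$. Every link between a user and a base station (BS) of length $R$ carries a fading $\mathcal H=e^{\xi}$ with $\xi\sim N(0,\sigma_B^2)$ and has gain $A_B\mathcal H R^{-\alpha_B}$; its *equivalent distance* is $\overline R=\mathcal H^{-1/\alpha_B}R$. Write $t=\left(\frac{\beta}{A_BP_B}\right)^{-1/\alpha_B}$. *Typical user.* BSs form a homogeneous Poisson point process (PPP) of intensity $\lambda_B$ in $\mathbb R^2$ with i.i.d. fadings towards a typical user at the origin. The user is served by the BS from which it receives the largest power $P^*=\max_b P_BA_B\mathcal H_bR_b^{-\alpha_B}$. It is in cellular mode if $P^*>\beta$, and in D2D mode otherwise; $q=\Pr[P^*>\beta]$. Let $\nu$ be the conditional law of (length, fading) of the serving link given $P^*>\beta$. A cellular user with serving link $(R,\mathcal H)$ transmits with power $P_0\left(\frac{R^{\alpha_B}}{\mathcal H A_B}\right)^{\varepsilon}$. *Typical BS at the origin.* The following three are independent. 1. The link $(R_{B,0},\mathcal H_{B,0})\sim\nu$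 to its own user. 2. The active cellular users of the other cells: a homogeneous PPP of intensity $\lambda_B$ with independent marks, namely the fading towards the typical BS and the user's own serving link (with law $\nu$, determining its transmit power). 3. The D2D users: a homogeneous PPP of intensity $(1-q)\lambda_u$ with independent marks, namely the fading towards the typical BS and a fair coin deciding whether the user is a transmitter; D2D transmitters use the constant power $P_d$. A point of 2 or 3 interferes only if the power it receives from the typical BS (through the same link) is at most $\beta$, i.e. if its equivalent distance to the typical BS is at least $t$. The SINR is the received power of the own user divided by the sum of the received interference powers of the cellular users and the D2D transmitters and of the noise power $\eta$. **Claim.** The equivalent serving distance $\overline{R_{B,0}}=\mathcal H_{B,0}^{-1/\alpha_B}R_{B,0}$ has on $(0,t]$ the probability density $$f(r)=\frac{2\pi\lambda_B r\exp\left(-\pi\lambda_Br^2e^{2\sigma_B^2/\alpha_B^2}+\frac{2\sigma_B^2}{\alpha_B^2}\right)}{1-\exp\left(-\pi\lambda_B\left(\frac{A_BP_B}{\beta}\right)^{2/\alpha_B}e^{2\sigma_B^2/\alpha_B^2}\right)},$$ and $$\Pr[\mathrm{SINR}>T]=\int_0^t\left(\int_{-\infty}^{\infty}\frac{e^{i\omega/T}-1}{2\pi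 i\omega}\,\mathcal F(r_0,\omega)\,d\omega\right)f(r_0)\,dr_0,$$ where both integrals converge absolutely. Here $\mathcal F(r_0,\omega)=\mathbb E\left[e^{-i\omega/\mathrm{SINR}}\,\middle|\,\overline{R_{B,0}}=r_0\right]$ is the conditional characteristic function of $1/\mathrm{SINR}$ (which is almost surely finite), and it is given, with absolutely convergent integrals over $(t,\infty)$, by $$\begin{aligned}\mathcal F(r_0,\omega)={}&\exp\left\{-2\pi\lambda_Be^{\frac{2\sigma_B^2}{\alpha_B^2}}\int_t^\infty\left(1-\int_0^t\exp\left(-\frac{i\omega}{r_0^{\alpha_B(\varepsilon-1)}}\,r^{\alpha_B\varepsilon}\tau^{-\alpha_B}\right)f(r)\,dr\right)\tau\,d\tau\right\}\\ &\times\exp\left\{-\pi(1-q)\lambda_ue^{\frac{2\sigma_B^2}{\alpha_B^2}}\int_t^\infty\left(1-\exp\left(-\frac{i\omega A_B^{\varepsilon}P_d}{P_0\,r_0^{\alpha_B(\varepsilon-1)}}\,L^{-\alpha_B}\right)\right)L\,dL\right\}\\ &\times\exp\left(-\frac{i\omega\eta}{\frac{P_0}{A_B^{\varepsilon-1}}\,r_0^{\alpha_B(\varepsilon-1)}}\right).\end{aligned}$$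 -/

import Mathlib

open MeasureTheory ProbabilityTheory Set
open scoped ENNReal

/-! ### Poisson point processes -/

/-- The number of points of the enumerated random configuration `{X 0, X 1, …}` (with
multiplicity) that lie in `B`. -/
noncomputable def pointCount {Ω E : Type*} (X : ℕ → Ω → E) (B : Set E) (ω : Ω) : ℝ≥0∞ :=
  Measure.count {n : ℕ | X n ω ∈ B}

/-- `{X 0, X 1, …}` is a Poisson point process on `E` with intensity measure `Λ`: counts in sets of
finite intensity are Poisson, counts in pairwise disjoint sets are independent.
If `E` is a product and `Λ` a product measure with a probability factor, this is an
independently marked Poisson process. -/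
structure IsPoissonProcess {Ω E : Type*} [MeasurableSpace Ω] [MeasurableSpace E]
    (X : ℕ → Ω → E) (Λ : Measure E) (P : Measure Ω) : Prop where
  measurable : ∀ n, Measurable (X n)
  law_count : ∀ B : Set E, MeasurableSet B → Λ B ≠ ∞ →
    HasLaw (pointCount X B) ((poissonMeasure (Λ B).toNNReal).map (Nat.cast : ℕ → ℝ≥0∞)) P
  indep_count : ∀ (k : ℕ) (B : Fin k → Set E), (∀ j, MeasurableSet (B j)) →
    Pairwise (fun i j => Disjoint (B i) (B j)) → iIndepFun (fun j => pointCount X (B j)) P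

/-! ### Network parameters, path loss, fading, power control -/

/-- The Euclidean plane. -/
abbrev Plane : Type := EuclideanSpace ℝ (Fin 2)

/-- Parameters of the network. -/
structure Network where
  /-- base station intensity -/
  lamB : ℝ
  /-- user intensity -/
  lamU : ℝ
  /-- path loss exponent of links between users and base stations -/
  α : ℝ
  /-- path loss constant of these links (linear scale) -/
  A : ℝ
  /-- standard deviation of the logarithm of the lognormal fading of these links -/
  σ : ℝ
  /-- transmit power of a base station -/
  PB : ℝ
  /-- transmit power of a D2D transmitter -/
  Pd : ℝ
  /-- mode selection threshold -/
  β : ℝ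
  /-- receiver sensitivity in the power control rule -/
  P0 : ℝ
  /-- fractional path loss compensation -/
  ε : ℝ
  /-- noise power at a base station -/
  η : ℝ
  lamB_pos : 0 < lamB
  lamU_pos : 0 < lamU
  two_lt_α : 2 < α
  A_pos : 0 < A
  σ_nonneg : 0 ≤ σ
  PB_pos : 0 < PB
  Pd_pos : 0 < Pd
  β_pos : 0 < β
  P0_pos : 0 < P0
  ε_pos : 0 < ε
  ε_le_one : ε ≤ 1
  η_nonneg : 0 ≤ η

namespace Network

variable (N : Network)

/-- Law of the lognormal fading coefficient `exp ξ`, `ξ ∼ N(0, σ²)`. -/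
noncomputable def fadingLaw : Measure ℝ :=
  (gaussianReal 0 (Real.toNNReal (N.σ ^ 2))).map Real.exp

/-- Gain of a link of length `R` with fading `h`. -/
noncomputable def gain (R h : ℝ) : ℝ := N.A * h * R ^ (-N.α)

/-- Power received over a link of length `R` with fading `h` from a base station. -/
noncomputable def downlinkPower (R h : ℝ) : ℝ := N.PB * N.gain R h

/-- Transmit power of a cellular user whose serving link has length `R` and fading `h`
(fractional channel inversion). -/
noncomputable def uplinkTxPower (R h : ℝ) : ℝ := N.P0 * (R ^ N.α / (h * N.A)) ^ N.ε

/-- Equivalent distance of a link of length `R` with fading `h`. -/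
noncomputable def equivDist (R h : ℝ) : ℝ := h ^ (-1 / N.α) * R

/-! ### A typical user at the origin: mode and serving link -/

/-- Intensity of the process of base stations `x`, each marked with its fading coefficient
towards the typical user. -/
noncomputable def bsIntensity : Measure (Plane × ℝ) :=
  ENNReal.ofReal N.lamB • (volume : Measure Plane).prod N.fadingLaw

/-- Index of the strongest base station in a configuration of (location, fading) pairs. -/
noncomputable def servingIndex (x : ℕ → Plane × ℝ) : ℕ :=
  sInf {n | ∀ m, N.downlinkPower ‖(x m).1‖ (x m).2 ≤ N.downlinkPower ‖(x n).1‖ (x n).2}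

/-- Length and fading of the link to the strongest base station. -/
noncomputable def servingLink (x : ℕ → Plane × ℝ) : ℝ × ℝ :=
  (‖(x (N.servingIndex x)).1‖, (x (N.servingIndex x)).2)

/-- The event that the typical user operates in cellular mode: the largest power received from
a base station exceeds `β`. -/
def cellularEvent {Ω : Type*} (Φb : ℕ → Ω → Plane × ℝ) : Set Ω :=
  {ω | ENNReal.ofReal N.β <
    ⨆ n, ENNReal.ofReal (N.downlinkPower ‖(Φb n ω).1‖ (Φb n ω).2)}

/-- The probability `q` that the typical user operates in cellular mode. -/
noncomputable def cellularProb {Ω : Type*} [MeasurableSpace Ω] (Φb : ℕ → Ω → Plane × ℝ)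
    (P : Measure Ω) : ℝ :=
  P.real (N.cellularEvent Φb)

/-- The law of (length, fading) of the serving link of a cellular user: the conditional law for
the typical user given that it operates in cellular mode. -/
noncomputable def servingLaw {Ω : Type*} [MeasurableSpace Ω] (Φb : ℕ → Ω → Plane × ℝ)
    (P : Measure Ω) : Measure (ℝ × ℝ) :=
  (ProbabilityTheory.cond P (N.cellularEvent Φb)).map (fun ω => N.servingLink (fun n => Φb n ω))

/-! ### A typical base station at the origin: interference and SINR -/

/-- Intensity of the active cellular users of the other cells: location, fading towards the typical
base station, and (length, fading) of the user's own serving link, distributed as `ν`. -/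
noncomputable def cuIntensity (ν : Measure (ℝ × ℝ)) : Measure ((Plane × ℝ) × (ℝ × ℝ)) :=
  (ENNReal.ofReal N.lamB • (volume : Measure Plane).prod N.fadingLaw).prod ν

/-- Intensity of the D2D users, `q` being the probability of cellular mode: location, fading towards
the typical base station, and a fair coin deciding whether the user transmits (`true`) or
receives (`false`). -/
noncomputable def d2dIntensity (q : ℝ) : Measure ((Plane × ℝ) × Bool) :=
  (ENNReal.ofReal ((1 - q) * N.lamU) • (volume : Measure Plane).prod N.fadingLaw).prod
    (uniformOn (univ : Set Bool))

/-- The random elements seen from the typical base station: its own serving link `L₀`, the active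
cellular users `Φc` of the other cells, and the D2D users `Φd`; they are independent. -/
structure IsUplinkModel {Ω : Type*} [MeasurableSpace Ω] (ν : Measure (ℝ × ℝ)) (q : ℝ)
    (L₀ : Ω → ℝ × ℝ) (Φc : ℕ → Ω → (Plane × ℝ) × (ℝ × ℝ)) (Φd : ℕ → Ω → (Plane × ℝ) × Bool)
    (P : Measure Ω) : Prop where
  measurable_link : Measurable L₀
  law_link : P.map L₀ = ν
  poisson_cu : IsPoissonProcess Φc (N.cuIntensity ν) P
  poisson_d2d : IsPoissonProcess Φd (N.d2dIntensity q) P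
  indep_cu_d2d : IndepFun (fun ω n => Φc n ω) (fun ω n => Φd n ω) P
  indep_link : IndepFun L₀ (fun ω => ((fun n => Φc n ω), (fun n => Φd n ω))) P

/-- Power received by the typical base station from its own user. -/
noncomputable def signal (l : ℝ × ℝ) : ℝ :=
  N.uplinkTxPower l.1 l.2 * N.gain l.1 l.2

/-- Interference from one cellular user. The users that receive more than `β` from the typical base
station are in its own cell and do not interfere. -/
noncomputable def cuInterference (p : (Plane × ℝ) × (ℝ × ℝ)) : ℝ :=
  if N.downlinkPower ‖p.1.1‖ p.1.2 ≤ N.β then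
    N.uplinkTxPower p.2.1 p.2.2 * N.gain ‖p.1.1‖ p.1.2 else 0

/-- Interference from one D2D user: it must be a transmitter, and, being in D2D mode, it receives
at most `β` from the typical base station. -/
noncomputable def d2dInterference (p : (Plane × ℝ) × Bool) : ℝ :=
  if p.2 = true ∧ N.downlinkPower ‖p.1.1‖ p.1.2 ≤ N.β then
    N.Pd * N.gain ‖p.1.1‖ p.1.2 else 0

/-- The SINR at the typical base station, as an extended nonnegative number. -/
noncomputable def sinr {Ω : Type*} (L₀ : Ω → ℝ × ℝ) (Φc : ℕ → Ω → (Plane × ℝ) × (ℝ × ℝ))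
    (Φd : ℕ → Ω → (Plane × ℝ) × Bool) (ω : Ω) : ℝ≥0∞ :=
  ENNReal.ofReal (N.signal (L₀ ω)) /
    ((∑' n, ENNReal.ofReal (N.cuInterference (Φc n ω))) +
      (∑' n, ENNReal.ofReal (N.d2dInterference (Φd n ω))) + ENNReal.ofReal N.η)

/-- Equivalent distance between the typical base station and its own user. -/
noncomputable def servingEquivDist {Ω : Type*} (L₀ : Ω → ℝ × ℝ) (ω : Ω) : ℝ :=
  N.equivDist (L₀ ω).1 (L₀ ω).2

/-! ### The closed-form expressions -/

/-- `t = (β / (A P_B)) ^ (-1/α)`. -/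
noncomputable def cellRadius : ℝ := (N.β / (N.A * N.PB)) ^ (-1 / N.α)

/-- The probability density on `(0, t]` of the equivalent serving distance. -/
noncomputable def servingPdf (r : ℝ) : ℝ :=
  2 * Real.pi * N.lamB * r *
      Real.exp (-Real.pi * N.lamB * r ^ 2 * Real.exp (2 * N.σ ^ 2 / N.α ^ 2)
        + 2 * N.σ ^ 2 / N.α ^ 2) /
    (1 - Real.exp (-Real.pi * N.lamB * (N.A * N.PB / N.β) ^ (2 / N.α)
      * Real.exp (2 * N.σ ^ 2 / N.α ^ 2)))

/-- Radial integrand for the cellular interferers, at serving distance `r₀` and frequency `w`. -/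
noncomputable def cuIntegrand (r₀ w τ : ℝ) : ℂ :=
  (1 - ∫ r in (0 : ℝ)..N.cellRadius,
      Complex.exp (-(Complex.I * w / (r₀ ^ (N.α * (N.ε - 1)) : ℝ)
        * (r ^ (N.α * N.ε) : ℝ) * (τ ^ (-N.α) : ℝ))) * (N.servingPdf r : ℂ)) * τ

/-- Radial integrand for the D2D interferers. -/
noncomputable def d2dIntegrand (r₀ w l : ℝ) : ℂ :=
  (1 - Complex.exp (-(Complex.I * w * (N.A ^ N.ε * N.Pd : ℝ)
      / (N.P0 * r₀ ^ (N.α * (N.ε - 1)) : ℝ) * (l ^ (-N.α) : ℝ)))) * l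

/-- The claimed conditional characteristic function of `1 / SINR` at frequency `w` given the
equivalent serving distance `r₀`. -/
noncomputable def condCharFun (q r₀ w : ℝ) : ℂ :=
  Complex.exp (-((2 * Real.pi * N.lamB * Real.exp (2 * N.σ ^ 2 / N.α ^ 2) : ℝ) : ℂ)
      * ∫ τ in Ioi N.cellRadius, N.cuIntegrand r₀ w τ)
  * Complex.exp (-((Real.pi * (1 - q) * N.lamU * Real.exp (2 * N.σ ^ 2 / N.α ^ 2) : ℝ) : ℂ)
      * ∫ l in Ioi N.cellRadius, N.d2dIntegrand r₀ w l)
  * Complex.exp (-(Complex.I * w * N.η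
      / (N.P0 / N.A ^ (N.ε - 1) * r₀ ^ (N.α * (N.ε - 1)) : ℝ)))

end Network

/-- The inversion kernel `(e^{iw/T} - 1) / (2π i w)`. -/
noncomputable def inversionKernel (T w : ℝ) : ℂ :=
  (Complex.exp (Complex.I * w / T) - 1) / (2 * Real.pi * Complex.I * w)

/-!
The equivalent distance of a link determines the power received over it, so the strongest base
station is the one at the smallest equivalent distance, and the typical user is in cellular mode
exactly when that distance is less than `t`. Replacing locations and fadings by equivalent distances
turns a marked Poisson process of intensity `λ` in the plane into a Poisson process on the half-line
in which the expected number of points closer than `r` is `π λ e^{2σ²/α²} r²`, where `e^{2σ²/α²}` is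
the moment `E[H^{2/α}]` of the fading. The void probability of the base station process therefore
gives a Rayleigh law for the smallest equivalent distance, and conditioning on cellular mode
truncates it at `t`.

Each interferer contributes a function of its equivalent distance `τ > t` and of an independent
mark, namely a nonnegative factor times `τ ^ (-α)`; the characteristic functional of a Poisson
process then produces the exponentials of radial integrals. Since `1 / SINR` is the sum of
interference and noise, which is independent of the serving link, divided by a power of the
equivalent serving distance, this computes its conditional characteristic function. The D2D
interference makes that function decay like `exp (-b |w| ^ (2/α))`, hence integrable, so Fourier
inversion recovers the conditional probability of `1 / SINR < 1 / T`, and averaging over the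
equivalent serving distance gives the coverage probability.
-/

open Filter Topology

section PoissonProcess

open scoped NNReal

lemma lintegral_natCast_poissonMeasure (r : ℝ≥0) :
    ∫⁻ n, (n : ℝ≥0∞) ∂(poissonMeasure r) = r := by
  have hterm (n : ℕ) : ((n + 1 : ℕ) : ℝ≥0∞) * poissonMeasure r {n + 1}
      = r * poissonMeasure r {n} := by
    rw [poissonMeasure_singleton, poissonMeasure_singleton, ← ENNReal.ofReal_natCast,
      ← ENNReal.ofReal_coe_nnreal, ← ENNReal.ofReal_mul (by positivity),
      ← ENNReal.ofReal_mul (by positivity), Nat.factorial_succ]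
    congr 1
    push_cast
    field_simp
    ring
  calc ∫⁻ n, (n : ℝ≥0∞) ∂(poissonMeasure r)
      = ∑' n : ℕ, (n : ℝ≥0∞) * poissonMeasure r {n} := lintegral_countable' _
    _ = ∑' n : ℕ, ((n + 1 : ℕ) : ℝ≥0∞) * poissonMeasure r {n + 1} := by
        rw [tsum_eq_zero_add' ENNReal.summable, Nat.cast_zero, zero_mul, zero_add]
    _ = r * ∑' n : ℕ, 1 * poissonMeasure r {n} := by
        simp_rw [hterm, one_mul, ENNReal.tsum_mul_left]
    _ = r := by rw [← lintegral_countable', lintegral_one, measure_univ, mul_one]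

variable {Ω E : Type*} {X : ℕ → Ω → E}

lemma pointCount_eq_tsum (X : ℕ → Ω → E) (B : Set E) (ω : Ω) :
    pointCount X B ω = ∑' n, B.indicator (fun _ => (1 : ℝ≥0∞)) (X n ω) := by
  rw [pointCount, ← lintegral_indicator_one (Set.to_countable _).measurableSet, lintegral_count]
  rfl

lemma finite_of_pointCount_ne_top {B : Set E} {ω : Ω} (h : pointCount X B ω ≠ ∞) :
    {n | X n ω ∈ B}.Finite :=
  Measure.count_apply_lt_top.1 h.lt_top

lemma hasSum_indicator_of_pointCount_ne_top {B : Set E} {ω : Ω} (h : pointCount X B ω ≠ ∞) :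
    HasSum (fun n => B.indicator (fun _ => (1 : ℝ)) (X n ω)) (pointCount X B ω).toReal := by
  rw [pointCount_eq_tsum] at h ⊢
  have hsum := ENNReal.hasSum_toReal h
  rw [← ENNReal.tsum_toReal_eq (ENNReal.ne_top_of_tsum_ne_top h)] at hsum
  refine hsum.congr_fun fun n => ?_
  by_cases hn : X n ω ∈ B <;> simp [hn]

variable [MeasurableSpace Ω] [MeasurableSpace E] {Λ : Measure E} {P : Measure Ω}

namespace IsPoissonProcess

variable (hX : IsPoissonProcess X Λ P)
include hX

lemma isProbabilityMeasure : IsProbabilityMeasure P :=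
  have := Measure.isProbabilityMeasure_map (μ := poissonMeasure (Λ ∅).toNNReal)
    (f := (Nat.cast : ℕ → ℝ≥0∞)) .of_discrete
  (hX.law_count ∅ .empty (by simp)).isProbabilityMeasure

lemma measurable_pointCount {B : Set E} (hB : MeasurableSet B) : Measurable (pointCount X B) := by
  rw [funext (pointCount_eq_tsum X B)]
  exact Measurable.tsum fun n => (measurable_const.indicator hB).comp (hX.measurable n)

lemma lintegral_pointCount {B : Set E} (hB : MeasurableSet B) (hfin : Λ B ≠ ∞) :
    ∫⁻ ω, pointCount X B ω ∂P = Λ B := by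
  rw [(hX.law_count B hB hfin).lintegral_comp (f := fun x => x) aemeasurable_id',
    lintegral_map measurable_id' .of_discrete, lintegral_natCast_poissonMeasure,
    ENNReal.coe_toNNReal hfin]

lemma ae_pointCount_ne_top {B : Set E} (hB : MeasurableSet B) (hfin : Λ B ≠ ∞) :
    ∀ᵐ ω ∂P, pointCount X B ω ≠ ∞ :=
  (ae_lt_top (hX.measurable_pointCount hB)
    (by rwa [hX.lintegral_pointCount hB hfin])).mono fun _ h => h.ne

lemma measure_pointCount_eq_zero {B : Set E} (hB : MeasurableSet B) (hfin : Λ B ≠ ∞) :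
    P {ω | pointCount X B ω = 0} = ENNReal.ofReal (Real.exp (-(Λ B).toReal)) := by
  have hpre : (Nat.cast : ℕ → ℝ≥0∞) ⁻¹' {x | x = 0} = {0} := by
    ext n
    simp
  rw [(hX.law_count B hB hfin).measure_eq (p := fun x => x = 0) (measurableSet_singleton _),
    Measure.map_apply .of_discrete (by simp), hpre, poissonMeasure_singleton]
  simp [ENNReal.coe_toNNReal_eq_toReal]

lemma sum_map_apply {B : Set E} (hB : MeasurableSet B) :
    Measure.sum (fun n => P.map (X n)) B = ∫⁻ ω, pointCount X B ω ∂P := by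
  simp_rw [pointCount_eq_tsum]
  rw [Measure.sum_apply _ hB, lintegral_tsum
    (f := fun n ω => B.indicator (fun _ => (1 : ℝ≥0∞)) (X n ω)) fun n =>
      ((measurable_const.indicator hB).comp (hX.measurable n)).aemeasurable]
  congr 1
  ext n
  rw [lintegral_indicator_const_comp (hX.measurable n) hB, one_mul,
    Measure.map_apply (hX.measurable n) hB]

lemma sum_map_eq [SigmaFinite Λ] : Measure.sum (fun n => P.map (X n)) = Λ := by
  refine (Measure.ext_iff_of_iUnion_eq_univ (iUnion_spanningSets Λ)).2 fun i => ?_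
  ext B hB
  have hS : MeasurableSet (B ∩ spanningSets Λ i) := hB.inter (measurableSet_spanningSets Λ i)
  have hfin : Λ (B ∩ spanningSets Λ i) ≠ ∞ :=
    ((measure_mono inter_subset_right).trans_lt (measure_spanningSets_lt_top Λ i)).ne
  rw [Measure.restrict_apply hB, Measure.restrict_apply hB, hX.sum_map_apply hS,
    hX.lintegral_pointCount hS hfin]

lemma lintegral_tsum_eq [SigmaFinite Λ] {g : E → ℝ≥0∞} (hg : Measurable g) :
    ∫⁻ ω, ∑' n, g (X n ω) ∂P = ∫⁻ x, g x ∂Λ := by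
  rw [lintegral_tsum (f := fun n ω => g (X n ω)) fun n => (hg.comp (hX.measurable n)).aemeasurable]
  conv_rhs => rw [← hX.sum_map_eq, lintegral_sum_measure]
  simp_rw [lintegral_map hg (hX.measurable _)]

lemma ae_forall_of_ae [SigmaFinite Λ] {p : E → Prop} (h : ∀ᵐ x ∂Λ, p x) :
    ∀ᵐ ω ∂P, ∀ n, p (X n ω) := by
  rw [← hX.sum_map_eq, Measure.ae_sum_iff] at h
  exact ae_all_iff.2 fun n => ae_of_ae_map (hX.measurable n).aemeasurable (h n)

lemma ae_summable [SigmaFinite Λ] {g : E → ℝ} (hg : Measurable g) (hi : Integrable g Λ) :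
    ∀ᵐ ω ∂P, Summable fun n => g (X n ω) := by
  have hfin : ∫⁻ ω, ∑' n, ‖g (X n ω)‖ₑ ∂P ≠ ∞ := by
    rw [hX.lintegral_tsum_eq hg.enorm]
    exact hi.2.ne
  have hm : Measurable fun ω => ∑' n, ‖g (X n ω)‖ₑ :=
    Measurable.tsum fun n => (hg.comp (hX.measurable n)).enorm
  filter_upwards [ae_lt_top hm hfin] with ω hω
  exact .of_norm (by simpa using ENNReal.summable_toReal hω.ne)

lemma iIndepFun_pointCount {ι : Type*} [Finite ι] {B : ι → Set E}
    (hB : ∀ i, MeasurableSet (B i)) (hd : Pairwise fun i j => Disjoint (B i) (B j)) :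
    iIndepFun (fun i => pointCount X (B i)) P := by
  have e := Finite.equivFin ι
  have h := hX.indep_count (Nat.card ι) (fun j => B (e.symm j)) (fun j => hB _)
    fun i j hij => hd (e.symm.injective.ne hij)
  simpa using h.precomp e.injective

lemma integral_exp_pointCount {B : Set E} (hB : MeasurableSet B) (hfin : Λ B ≠ ∞) (c : ℝ) :
    ∫ ω, Complex.exp (Complex.I * ((c * (pointCount X B ω).toReal : ℝ) : ℂ)) ∂P
      = Complex.exp (Λ.real B * (Complex.exp (Complex.I * c) - 1)) := by
  have hchar := charFun_map_cast_poissonMeasure (Λ B).toNNReal c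
  rw [charFun_apply, integral_map .of_discrete (by fun_prop)] at hchar
  refine ((hX.law_count B hB hfin).integral_comp (f := fun x : ℝ≥0∞ =>
    Complex.exp (Complex.I * ((c * x.toReal : ℝ) : ℂ)))
    (Measurable.aestronglyMeasurable (by fun_prop))).trans ?_
  rw [integral_map .of_discrete (Measurable.aestronglyMeasurable (by fun_prop)),
    mul_comm Complex.I (c : ℂ), Measure.real, ← ENNReal.coe_toNNReal_eq_toReal, ← hchar]
  refine integral_congr_ae (ae_of_all _ fun n => ?_)
  simp [mul_comm]

end IsPoissonProcess

lemma simpleFunc_eq_sum_indicator {F : Type*} [AddCommMonoid F] [DecidableEq F]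
    (s : SimpleFunc E F) (x : E) :
    s x = ∑ c : {c // c ∈ s.range.filter (· ≠ 0)}, (s ⁻¹' {c.1}).indicator (fun _ => c.1) x := by
  rw [Finset.sum_coe_sort (s.range.filter (· ≠ 0)) fun c => (s ⁻¹' {c}).indicator (fun _ => c) x]
  by_cases hx : s x = 0 <;> simp [indicator, hx]

lemma norm_exp_I_mul_sub_exp_I_mul_le (x y : ℝ) :
    ‖Complex.exp (Complex.I * x) - Complex.exp (Complex.I * y)‖ ≤ |x - y| := by
  have hfactor : Complex.exp (Complex.I * x) - Complex.exp (Complex.I * y)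
      = Complex.exp (y * Complex.I) * (Complex.exp (Complex.I * ((x - y : ℝ) : ℂ)) - 1) := by
    rw [mul_sub, ← Complex.exp_add, mul_one]
    push_cast
    ring_nf
  rw [hfactor, norm_mul, Complex.norm_exp_ofReal_mul_I, one_mul]
  exact Real.norm_exp_I_mul_ofReal_sub_one_le

lemma enorm_exp_I_mul_sub_exp_I_mul_le (x y : ℝ) :
    ‖Complex.exp (Complex.I * x) - Complex.exp (Complex.I * y)‖ₑ ≤ ‖x - y‖ₑ := by
  rw [← ofReal_norm, ← ofReal_norm]
  exact ENNReal.ofReal_le_ofReal (norm_exp_I_mul_sub_exp_I_mul_le x y)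

lemma integrable_exp_I_mul_sub_one {g : E → ℝ} (hi : Integrable g Λ) :
    Integrable (fun x => Complex.exp (Complex.I * (g x : ℂ)) - 1) Λ :=
  hi.mono ((Continuous.comp_aestronglyMeasurable (g := fun y : ℝ =>
      Complex.exp (Complex.I * (y : ℂ)) - 1) (by fun_prop) hi.1))
    (ae_of_all _ fun _ => Real.norm_exp_I_mul_ofReal_sub_one_le)

namespace IsPoissonProcess

variable (hX : IsPoissonProcess X Λ P)
include hX

lemma ae_hasSum_simpleFunc (s : SimpleFunc E ℝ) (hs : Integrable s Λ) :
    ∀ᵐ ω ∂P, HasSum (fun n => s (X n ω)) (∑ c : {c // c ∈ s.range.filter (· ≠ 0)},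
      c.1 * (pointCount X (s ⁻¹' {c.1}) ω).toReal) := by
  have hcount : ∀ᵐ ω ∂P, ∀ c : {c // c ∈ s.range.filter (· ≠ 0)},
      pointCount X (s ⁻¹' {c.1}) ω ≠ ∞ := ae_all_iff.2 fun c =>
    hX.ae_pointCount_ne_top (s.measurableSet_preimage _)
      (s.measure_preimage_lt_top_of_integrable hs (Finset.mem_filter.1 c.2).2).ne
  filter_upwards [hcount] with ω hω
  refine (hasSum_sum fun c _ => (hasSum_indicator_of_pointCount_ne_top (hω c)).mul_left
    c.1).congr_fun fun n => ?_
  rw [simpleFunc_eq_sum_indicator s (X n ω)]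
  simp [indicator]

lemma integral_exp_tsum_simpleFunc (s : SimpleFunc E ℝ) (hs : Integrable s Λ) :
    ∫ ω, Complex.exp (Complex.I * ((∑' n, s (X n ω) : ℝ) : ℂ)) ∂P
      = Complex.exp (∫ x, (Complex.exp (Complex.I * (s x : ℂ)) - 1) ∂Λ) := by
  have hB (c : {c // c ∈ s.range.filter (· ≠ 0)}) : MeasurableSet (s ⁻¹' {c.1}) :=
    s.measurableSet_preimage _
  have hind := (hX.iIndepFun_pointCount hB fun i j hij => Disjoint.preimage _
    (disjoint_singleton.2 (Subtype.coe_ne_coe.2 hij))).comp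
      (fun c x => Complex.exp (Complex.I * ((c.1 * x.toReal : ℝ) : ℂ))) fun c => by fun_prop
  have hexponent : ∫ x, (Complex.exp (Complex.I * (s x : ℂ)) - 1) ∂Λ
      = ∑ c : {c // c ∈ s.range.filter (· ≠ 0)},
        (Λ.real (s ⁻¹' {c.1}) * (Complex.exp (Complex.I * c.1) - 1) : ℂ) := by
    let φ (c : ℝ) : ℂ := Complex.exp (Complex.I * c) - 1
    have h := SimpleFunc.map_integral s φ hs (by simp [φ])
    rw [SimpleFunc.integral_eq_integral _ (integrable_exp_I_mul_sub_one hs)] at h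
    refine h.trans ?_
    rw [Finset.sum_coe_sort (s.range.filter (· ≠ 0))
      fun c => (Λ.real (s ⁻¹' {c}) * (Complex.exp (Complex.I * c) - 1) : ℂ)]
    refine (Finset.sum_filter_of_ne fun c _ hc => ?_).symm
    rintro rfl
    simp [φ] at hc
  calc ∫ ω, Complex.exp (Complex.I * ((∑' n, s (X n ω) : ℝ) : ℂ)) ∂P
      = ∫ ω, ∏ c : {c // c ∈ s.range.filter (· ≠ 0)}, Complex.exp (Complex.I *
          ((c.1 * (pointCount X (s ⁻¹' {c.1}) ω).toReal : ℝ) : ℂ)) ∂P := by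
        refine integral_congr_ae ?_
        filter_upwards [hX.ae_hasSum_simpleFunc s hs] with ω hω
        rw [hω.tsum_eq, ← Complex.exp_sum, Complex.ofReal_sum, Finset.mul_sum]
    _ = ∏ c : {c // c ∈ s.range.filter (· ≠ 0)}, ∫ ω, Complex.exp (Complex.I *
          ((c.1 * (pointCount X (s ⁻¹' {c.1}) ω).toReal : ℝ) : ℂ)) ∂P :=
        hind.integral_fun_prod_eq_prod_integral fun c => by
          have := hX.measurable_pointCount (hB c)
          exact Measurable.aestronglyMeasurable (by fun_prop)
    _ = Complex.exp (∫ x, (Complex.exp (Complex.I * (s x : ℂ)) - 1) ∂Λ) := by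
        rw [hexponent, Complex.exp_sum]
        exact Finset.prod_congr rfl fun c _ => hX.integral_exp_pointCount (hB c)
          (s.measure_preimage_lt_top_of_integrable hs (Finset.mem_filter.1 c.2).2).ne c.1

lemma integrable_exp_tsum [SigmaFinite Λ] {g : E → ℝ} (hg : Measurable g) (hi : Integrable g Λ) :
    Integrable (fun ω => Complex.exp (Complex.I * ((∑' n, g (X n ω) : ℝ) : ℂ))) P := by
  have := hX.isProbabilityMeasure
  have hsum : AEMeasurable (fun ω => ∑' n, g (X n ω)) P := by
    refine aemeasurable_of_tendsto_metrizable_ae atTop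
      (f := fun k ω => ∑ n ∈ Finset.range k, g (X n ω))
      (fun k => (Finset.measurable_sum _ fun n _ => hg.comp (hX.measurable n)).aemeasurable) ?_
    filter_upwards [hX.ae_summable hg hi] with ω hω using hω.hasSum.tendsto_sum_nat
  refine Integrable.of_bound (AEMeasurable.aestronglyMeasurable (by fun_prop)) 1
    (ae_of_all _ fun ω => ?_)
  rw [mul_comm, Complex.norm_exp_ofReal_mul_I]

lemma lintegral_enorm_exp_tsum_sub_le [SigmaFinite Λ] {f g : E → ℝ} (hf : Measurable f)
    (hfi : Integrable f Λ) (hg : Measurable g) (hgi : Integrable g Λ) :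
    ∫⁻ ω, ‖Complex.exp (Complex.I * ((∑' n, f (X n ω) : ℝ) : ℂ))
        - Complex.exp (Complex.I * ((∑' n, g (X n ω) : ℝ) : ℂ))‖ₑ ∂P
      ≤ ∫⁻ x, ‖f x - g x‖ₑ ∂Λ := by
  rw [← hX.lintegral_tsum_eq (g := fun x => ‖f x - g x‖ₑ) (hf.sub hg).enorm]
  refine lintegral_mono_ae ?_
  filter_upwards [hX.ae_summable hf hfi, hX.ae_summable hg hgi] with ω hsf hsg
  refine (enorm_exp_I_mul_sub_exp_I_mul_le _ _).trans ?_
  rw [← hsf.tsum_sub hsg]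
  exact enorm_tsum_le_tsum_enorm

-- Both sides are continuous in `g` for the `L¹` norm, so simple functions suffice.
theorem integral_exp_tsum [SigmaFinite Λ] {g : E → ℝ} (hg : Measurable g) (hi : Integrable g Λ) :
    ∫ ω, Complex.exp (Complex.I * ((∑' n, g (X n ω) : ℝ) : ℂ)) ∂P
      = Complex.exp (∫ x, (Complex.exp (Complex.I * (g x : ℂ)) - 1) ∂Λ) := by
  let s : ℕ → SimpleFunc E ℝ := SimpleFunc.approxOn g hg (range g ∪ {0}) 0 (by simp)
  have hsi : ∀ k, Integrable (s k) Λ := SimpleFunc.integrable_approxOn_range hg hi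
  have hs : Tendsto (fun k => ∫⁻ x, ‖s k x - g x‖ₑ ∂Λ) atTop (𝓝 0) :=
    SimpleFunc.tendsto_approxOn_range_L1_enorm hg hi
  have hleft : Tendsto (fun k => ∫ ω, Complex.exp (Complex.I * ((∑' n, s k (X n ω) : ℝ) : ℂ)) ∂P)
      atTop (𝓝 (∫ ω, Complex.exp (Complex.I * ((∑' n, g (X n ω) : ℝ) : ℂ)) ∂P)) :=
    tendsto_integral_of_L1 _ (hX.integrable_exp_tsum hg hi).1
      (.of_forall fun k => hX.integrable_exp_tsum (s k).measurable (hsi k))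
      (tendsto_of_tendsto_of_tendsto_of_le_of_le tendsto_const_nhds hs (fun _ => zero_le)
        fun k => hX.lintegral_enorm_exp_tsum_sub_le (s k).measurable (hsi k) hg hi)
  have hexponent : Tendsto (fun k => ∫ x, (Complex.exp (Complex.I * (s k x : ℂ)) - 1) ∂Λ)
      atTop (𝓝 (∫ x, (Complex.exp (Complex.I * (g x : ℂ)) - 1) ∂Λ)) := by
    refine tendsto_integral_of_L1 _ (integrable_exp_I_mul_sub_one hi).1
      (.of_forall fun k => integrable_exp_I_mul_sub_one (hsi k))
      (tendsto_of_tendsto_of_tendsto_of_le_of_le tendsto_const_nhds hs (fun _ => zero_le)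
        fun k => lintegral_mono fun x => ?_)
    rw [sub_sub_sub_cancel_right]
    exact enorm_exp_I_mul_sub_exp_I_mul_le _ _
  refine tendsto_nhds_unique hleft ?_
  simp_rw [fun k => hX.integral_exp_tsum_simpleFunc (s k) (hsi k)]
  exact (Complex.continuous_exp.tendsto _).comp hexponent

end IsPoissonProcess

end PoissonProcess

section RealMeasures

lemma measure_ext_of_Iic_of_ne_top {α : Type*} [MeasurableSpace α] [LinearOrder α]
    [TopologicalSpace α] [OrderTopology α] [SecondCountableTopology α] [BorelSpace α]
    {μ ν : Measure α} (hfin : ∀ a, μ (Iic a) ≠ ∞) (h : ∀ a, μ (Iic a) = ν (Iic a)) : μ = ν := by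
  cases isEmpty_or_nonempty α
  · exact Subsingleton.elim _ _
  obtain ⟨u, -, hu⟩ := exists_seq_monotone_tendsto_atTop_atTop α
  refine Measure.ext_of_generateFrom_of_iUnion (range Iic) (fun n => Iic (u n))
    ((BorelSpace.measurable_eq (α := α)).trans (borel_eq_generateFrom_Iic α)) isPiSystem_Iic
    (eq_univ_of_forall fun x => mem_iUnion.2 (hu.eventually_ge_atTop x).exists)
    (fun n => mem_range_self _) (fun n => hfin _) ?_
  rintro _ ⟨a, rfl⟩
  exact h a

lemma lintegral_Ioc_ofReal_of_hasDerivAt {F f : ℝ → ℝ} {a b : ℝ} (hab : a ≤ b)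
    (hf : Continuous f) (hd : ∀ x, HasDerivAt F (f x) x) (h0 : ∀ x ∈ Ioc a b, 0 ≤ f x) :
    ∫⁻ x in Ioc a b, ENNReal.ofReal (f x) = ENNReal.ofReal (F b - F a) := by
  rw [← ofReal_integral_eq_lintegral_ofReal (hf.integrableOn_Icc.mono_set Ioc_subset_Icc_self)
    ((ae_restrict_iff' measurableSet_Ioc).2 (ae_of_all _ h0)),
    ← intervalIntegral.integral_of_le hab,
    intervalIntegral.integral_eq_sub_of_hasDerivAt (fun x _ => hd x) (hf.intervalIntegrable _ _)]

lemma withDensity_restrict_Ioi_Iic (f : ℝ → ℝ≥0∞) (a r : ℝ) :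
    (volume.restrict (Ioi a)).withDensity f (Iic r) = ∫⁻ x in Ioc a r, f x := by
  rw [withDensity_apply _ measurableSet_Iic, Measure.restrict_restrict measurableSet_Iic,
    inter_comm, Ioi_inter_Iic]

/-- The image of `c` times Lebesgue measure on the plane under the Euclidean norm. -/
noncomputable def radialMeasure (c : ℝ) : Measure ℝ :=
  (volume.restrict (Ioi 0)).withDensity (fun r => ENNReal.ofReal (2 * Real.pi * c * r))

lemma radialMeasure_Iic {c : ℝ} (hc : 0 ≤ c) (r : ℝ) :
    radialMeasure c (Iic r) = ENNReal.ofReal (Real.pi * c * (max r 0) ^ 2) := by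
  rw [radialMeasure, withDensity_restrict_Ioi_Iic]
  rcases le_total r 0 with h | h
  · simp [h]
  have hderiv (x : ℝ) : HasDerivAt (fun x => Real.pi * c * x ^ 2) (2 * Real.pi * c * x) x := by
    refine ((hasDerivAt_pow 2 x).const_mul (Real.pi * c)).congr_deriv ?_
    norm_num
    ring
  rw [lintegral_Ioc_ofReal_of_hasDerivAt h (by fun_prop) hderiv fun x hx => by
    have := hx.1
    positivity]
  simp [h]

/-- The Rayleigh distribution with density `2 k x exp (-k x²)` on `(0, ∞)`: the law of the distance
from the origin to the nearest point of a Poisson process in the plane of intensity `k / π`. -/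
noncomputable def rayleighMeasure (k : ℝ) : Measure ℝ :=
  (volume.restrict (Ioi 0)).withDensity
    fun x => ENNReal.ofReal (2 * k * x * Real.exp (-k * x ^ 2))

lemma rayleighMeasure_Iic {k : ℝ} (hk : 0 ≤ k) (r : ℝ) :
    rayleighMeasure k (Iic r) = ENNReal.ofReal (1 - Real.exp (-k * (max r 0) ^ 2)) := by
  rw [rayleighMeasure, withDensity_restrict_Ioi_Iic]
  rcases le_total r 0 with h | h
  · simp [h]
  have hderiv (x : ℝ) : HasDerivAt (fun x => -Real.exp (-k * x ^ 2))
      (2 * k * x * Real.exp (-k * x ^ 2)) x := by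
    refine (((hasDerivAt_pow 2 x).const_mul (-k)).exp.neg).congr_deriv ?_
    norm_num
    ring
  rw [lintegral_Ioc_ofReal_of_hasDerivAt h (by fun_prop) hderiv fun x hx => by
    have := hx.1
    positivity]
  simp [h, neg_add_eq_sub]

lemma rayleighMeasure_Iio {k : ℝ} (hk : 0 ≤ k) (r : ℝ) :
    rayleighMeasure k (Iio r) = ENNReal.ofReal (1 - Real.exp (-k * (max r 0) ^ 2)) := by
  rw [← rayleighMeasure_Iic hk]
  exact measure_congr (Iio_ae_eq_Iic' (withDensity_absolutelyContinuous _ _ (by simp)))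

end RealMeasures

lemma measurable_sInf_nat {Ω : Type*} [MeasurableSpace Ω] {S : Ω → Set ℕ}
    (hS : ∀ n, MeasurableSet {ω | n ∈ S ω}) : Measurable fun ω => sInf (S ω) := by
  refine measurable_of_Iic fun k => ?_
  have hset : (fun ω => sInf (S ω)) ⁻¹' Iic k
      = (⋃ n ∈ Iic k, {ω | n ∈ S ω}) ∪ ⋂ n, {ω | n ∈ S ω}ᶜ := by
    ext ω
    simp only [mem_preimage, mem_Iic, mem_union, mem_iUnion, mem_iInter, mem_compl_iff,
      mem_ofPred_eq, exists_prop]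
    constructor
    · intro hk
      rcases (S ω).eq_empty_or_nonempty with hempty | hne
      · exact .inr fun n => hempty ▸ notMem_empty n
      · exact .inl ⟨_, hk, Nat.sInf_mem hne⟩
    · rintro (⟨n, hn, hmem⟩ | hempty)
      · exact (Nat.sInf_le hmem).trans hn
      · simp [eq_empty_of_forall_notMem hempty]
  rw [hset]
  exact (MeasurableSet.biUnion (to_countable _) fun n _ => hS n).union
    (.iInter fun n => (hS n).compl)

namespace Network

section EquivDist

variable (N : Network)

lemma α_pos : 0 < N.α := by linarith [N.two_lt_α]

lemma cellRadius_pos : 0 < N.cellRadius :=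
  Real.rpow_pos_of_pos (div_pos N.β_pos (mul_pos N.A_pos N.PB_pos)) _

/-- The factor `e^{2σ²/α²}`, the moment of order `2 / α` of the fading, by which fading scales the
planar intensity of equivalent distances. -/
noncomputable def fadingScale : ℝ := Real.exp (2 * N.σ ^ 2 / N.α ^ 2)

lemma fadingScale_pos : 0 < N.fadingScale := Real.exp_pos _

instance isProbabilityMeasure_fadingLaw : IsProbabilityMeasure N.fadingLaw :=
  Measure.isProbabilityMeasure_map (by fun_prop)

lemma ae_fadingLaw_pos : ∀ᵐ h ∂N.fadingLaw, 0 < h := by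
  rw [fadingLaw, ae_map_iff (by fun_prop) measurableSet_Ioi]
  exact ae_of_all _ Real.exp_pos

lemma lintegral_rpow_fadingLaw (c : ℝ) (hc : 0 ≤ c) :
    ∫⁻ h, ENNReal.ofReal (c * h ^ (2 / N.α)) ∂N.fadingLaw = ENNReal.ofReal (c * N.fadingScale) := by
  have hmgf := congrFun (mgf_id_gaussianReal (μ := 0) (v := Real.toNNReal (N.σ ^ 2))) (2 / N.α)
  simp only [mgf, id] at hmgf
  rw [fadingLaw, lintegral_map (by fun_prop) (by fun_prop)]
  simp_rw [← Real.exp_mul, mul_comm _ (2 / N.α)]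
  rw [← ofReal_integral_eq_lintegral_ofReal ((integrable_exp_mul_gaussianReal _).const_mul c)
    (ae_of_all _ fun x => by positivity), integral_const_mul, hmgf, fadingScale,
    Real.coe_toNNReal _ (sq_nonneg _)]
  congr 3
  field_simp
  ring

lemma measurable_equivDist : Measurable fun p : ℝ × ℝ => N.equivDist p.1 p.2 := by
  unfold equivDist
  fun_prop

@[fun_prop]
lemma measurable_equivDist_comp {E : Type*} [MeasurableSpace E] {f g : E → ℝ} (hf : Measurable f)
    (hg : Measurable g) : Measurable fun x => N.equivDist (f x) (g x) :=
  N.measurable_equivDist.comp (hf.prodMk hg)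

@[fun_prop]
lemma measurable_downlinkPower {E : Type*} [MeasurableSpace E] {f g : E → ℝ} (hf : Measurable f)
    (hg : Measurable g) : Measurable fun x => N.downlinkPower (f x) (g x) := by
  unfold downlinkPower gain
  fun_prop

lemma measurableSet_equivDist_norm_le (r : ℝ) :
    MeasurableSet {p : Plane × ℝ | N.equivDist ‖p.1‖ p.2 ≤ r} :=
  measurableSet_le (by fun_prop) measurable_const

lemma equivDist_le_iff {h r : ℝ} (hh : 0 < h) (R : ℝ) :
    N.equivDist R h ≤ r ↔ R ≤ h ^ (1 / N.α) * r := by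
  rw [equivDist, neg_div, Real.rpow_neg hh.le, inv_mul_le_iff₀ (Real.rpow_pos_of_pos hh _)]

lemma volume_equivDist_norm_le {h : ℝ} (hh : 0 < h) (r : ℝ) :
    volume {x : Plane | N.equivDist ‖x‖ h ≤ r}
      = ENNReal.ofReal (Real.pi * (max r 0) ^ 2 * h ^ (2 / N.α)) := by
  have hball : {x : Plane | N.equivDist ‖x‖ h ≤ r}
      = Metric.closedBall 0 (h ^ (1 / N.α) * r) := by
    ext x
    simp [N.equivDist_le_iff hh]
  have hradius : ENNReal.ofReal (h ^ (1 / N.α) * r)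
      = ENNReal.ofReal (h ^ (1 / N.α) * max r 0) := by
    rw [ENNReal.ofReal_mul (by positivity), ENNReal.ofReal_mul (by positivity)]
    simp [ENNReal.ofReal, Real.toNNReal]
  have hsq : h ^ (2 / N.α) = (h ^ (1 / N.α)) ^ 2 := by
    rw [← Real.rpow_mul_natCast hh.le, one_div_mul_eq_div, Nat.cast_ofNat]
  rw [hball, EuclideanSpace.volume_closedBall_fin_two, hradius,
    ← ENNReal.ofReal_pow (by positivity), ← ENNReal.ofReal_mul (by positivity), hsq]
  congr 1
  ring

lemma map_equivDist : ((volume : Measure Plane).prod N.fadingLaw).map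
    (fun p => N.equivDist ‖p.1‖ p.2) = radialMeasure N.fadingScale := by
  have hm : Measurable fun p : Plane × ℝ => N.equivDist ‖p.1‖ p.2 := by fun_prop
  have hIic (r : ℝ) : ((volume : Measure Plane).prod N.fadingLaw).map
      (fun p => N.equivDist ‖p.1‖ p.2) (Iic r) = radialMeasure N.fadingScale (Iic r) := by
    rw [Measure.map_apply hm measurableSet_Iic, Measure.prod_apply_symm (hm measurableSet_Iic),
      radialMeasure_Iic N.fadingScale_pos.le, mul_right_comm,
      ← N.lintegral_rpow_fadingLaw _ (by positivity)]
    refine lintegral_congr_ae ?_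
    filter_upwards [N.ae_fadingLaw_pos] with h hh using N.volume_equivDist_norm_le hh r
  refine measure_ext_of_Iic_of_ne_top (fun r => ?_) hIic
  rw [hIic, radialMeasure_Iic N.fadingScale_pos.le]
  exact ENNReal.ofReal_ne_top

lemma ae_pos_pos : ∀ᵐ p ∂((volume : Measure Plane).prod N.fadingLaw), 0 < ‖p.1‖ ∧ 0 < p.2 := by
  have hnorm : ∀ᵐ x ∂(volume : Measure Plane), 0 < ‖x‖ :=
    (Measure.ae_ne volume 0).mono fun x hx => norm_pos_iff.2 hx
  exact (Measure.quasiMeasurePreserving_fst.ae hnorm).and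
    (Measure.quasiMeasurePreserving_snd.ae N.ae_fadingLaw_pos)

variable {N}

lemma equivDist_pos {R h : ℝ} (hR : 0 < R) (hh : 0 < h) : 0 < N.equivDist R h :=
  mul_pos (Real.rpow_pos_of_pos hh _) hR

lemma equivDist_rpow {R h : ℝ} (hR : 0 < R) (hh : 0 < h) :
    N.equivDist R h ^ N.α = h⁻¹ * R ^ N.α := by
  have := N.α_pos
  rw [equivDist, Real.mul_rpow (Real.rpow_nonneg hh.le _) hR.le, ← Real.rpow_mul hh.le,
    div_mul_cancel₀ _ this.ne', Real.rpow_neg_one]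

lemma gain_eq {R h : ℝ} (hR : 0 < R) (hh : 0 < h) :
    N.gain R h = N.A * N.equivDist R h ^ (-N.α) := by
  rw [Real.rpow_neg (equivDist_pos hR hh).le, equivDist_rpow hR hh, gain, Real.rpow_neg hR.le,
    mul_inv, inv_inv, mul_assoc]

lemma uplinkTxPower_eq {R h : ℝ} (hR : 0 < R) (hh : 0 < h) :
    N.uplinkTxPower R h = N.P0 * N.A ^ (-N.ε) * N.equivDist R h ^ (N.α * N.ε) := by
  have := N.A_pos
  rw [uplinkTxPower, Real.rpow_mul (equivDist_pos hR hh).le, equivDist_rpow hR hh,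
    show R ^ N.α / (h * N.A) = N.A⁻¹ * (h⁻¹ * R ^ N.α) by field_simp,
    Real.mul_rpow (by positivity) (by positivity), Real.rpow_neg this.le,
    Real.inv_rpow this.le, mul_assoc]

lemma downlinkPower_eq {R h : ℝ} (hR : 0 < R) (hh : 0 < h) :
    N.downlinkPower R h = N.PB * N.A * N.equivDist R h ^ (-N.α) := by
  rw [downlinkPower, gain_eq hR hh, mul_assoc]

lemma β_eq : N.β = N.PB * N.A * N.cellRadius ^ (-N.α) := by
  have := N.α_pos
  have := N.PB_pos
  have := N.A_pos
  have := N.β_pos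
  rw [cellRadius, ← Real.rpow_mul (by positivity), show -1 / N.α * -N.α = 1 by field_simp,
    Real.rpow_one]
  field_simp

lemma power_le_power_iff {x y : ℝ} (hx : 0 < x) (hy : 0 < y) :
    N.PB * N.A * x ^ (-N.α) ≤ N.PB * N.A * y ^ (-N.α) ↔ y ≤ x := by
  rw [mul_le_mul_iff_right₀ (mul_pos N.PB_pos N.A_pos),
    Real.rpow_le_rpow_iff_of_neg hx hy (neg_neg_of_pos N.α_pos)]

lemma downlinkPower_le_downlinkPower_iff {R h R' h' : ℝ} (hR : 0 < R) (hh : 0 < h) (hR' : 0 < R')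
    (hh' : 0 < h') :
    N.downlinkPower R h ≤ N.downlinkPower R' h' ↔ N.equivDist R' h' ≤ N.equivDist R h := by
  rw [downlinkPower_eq hR hh, downlinkPower_eq hR' hh',
    power_le_power_iff (equivDist_pos hR hh) (equivDist_pos hR' hh')]

lemma downlinkPower_le_β_iff {R h : ℝ} (hR : 0 < R) (hh : 0 < h) :
    N.downlinkPower R h ≤ N.β ↔ N.cellRadius ≤ N.equivDist R h := by
  rw [downlinkPower_eq hR hh, β_eq, power_le_power_iff (equivDist_pos hR hh) N.cellRadius_pos]

end EquivDist

section ServingDistance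

variable (N : Network)

instance sigmaFinite_bsIntensity : SigmaFinite N.bsIntensity :=
  inferInstanceAs (SigmaFinite (Real.toNNReal N.lamB • (volume : Measure Plane).prod N.fadingLaw))

lemma ae_bsIntensity_pos : ∀ᵐ p ∂N.bsIntensity, 0 < ‖p.1‖ ∧ 0 < p.2 :=
  Measure.ae_smul_measure N.ae_pos_pos _

/-- The rate `k` in the Rayleigh law `rayleighMeasure k` of the smallest equivalent distance. -/
noncomputable def nearestRate : ℝ := Real.pi * N.lamB * N.fadingScale

lemma nearestRate_pos : 0 < N.nearestRate :=
  mul_pos (mul_pos Real.pi_pos N.lamB_pos) N.fadingScale_pos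

lemma bsIntensity_equivDist_le (r : ℝ) :
    N.bsIntensity {p | N.equivDist ‖p.1‖ p.2 ≤ r}
      = ENNReal.ofReal (N.nearestRate * (max r 0) ^ 2) := by
  change (ENNReal.ofReal N.lamB • (volume : Measure Plane).prod N.fadingLaw)
    ((fun p => N.equivDist ‖p.1‖ p.2) ⁻¹' Iic r) = _
  rw [Measure.smul_apply, ← Measure.map_apply (by fun_prop) measurableSet_Iic, N.map_equivDist,
    radialMeasure_Iic N.fadingScale_pos.le, smul_eq_mul, ← ENNReal.ofReal_mul N.lamB_pos.le,
    nearestRate]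
  congr 1
  ring

variable {Ω₀ : Type*} [MeasurableSpace Ω₀] {P₀ : Measure Ω₀} {Φb : ℕ → Ω₀ → Plane × ℝ}

lemma measurable_servingIndex (hm : ∀ n, Measurable (Φb n)) :
    Measurable fun ω => N.servingIndex (fun n => Φb n ω) := by
  refine measurable_sInf_nat fun n => ?_
  change MeasurableSet {ω | ∀ m, N.downlinkPower ‖(Φb m ω).1‖ (Φb m ω).2
    ≤ N.downlinkPower ‖(Φb n ω).1‖ (Φb n ω).2}
  rw [ofPred_forall]
  exact .iInter fun m => measurableSet_le
    (N.measurable_downlinkPower (hm m).fst.norm (hm m).snd)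
    (N.measurable_downlinkPower (hm n).fst.norm (hm n).snd)

lemma measurable_servingLink (hm : ∀ n, Measurable (Φb n)) :
    Measurable fun ω => N.servingLink (fun n => Φb n ω) := by
  have hserving : Measurable fun ω => Φb (N.servingIndex (fun n => Φb n ω)) ω :=
    (measurable_from_prod_countable_right hm : Measurable fun q : ℕ × Ω₀ => Φb q.1 q.2).comp
      ((N.measurable_servingIndex hm).prodMk measurable_id)
  exact hserving.fst.norm.prodMk hserving.snd

/-- The equivalent distance from the typical user to its serving base station, which is the smallest
equivalent distance to any base station. -/
noncomputable def nearestDist (Φb : ℕ → Ω₀ → Plane × ℝ) (ω : Ω₀) : ℝ :=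
  N.equivDist (N.servingLink fun n => Φb n ω).1 (N.servingLink fun n => Φb n ω).2

lemma measurable_nearestDist (hm : ∀ n, Measurable (Φb n)) : Measurable (N.nearestDist Φb) :=
  N.measurable_equivDist.comp (N.measurable_servingLink hm)

variable {N} (hb : IsPoissonProcess Φb N.bsIntensity P₀)
include hb

lemma ae_forall_pos : ∀ᵐ ω ∂P₀, ∀ n, 0 < ‖(Φb n ω).1‖ ∧ 0 < (Φb n ω).2 :=
  hb.ae_forall_of_ae N.ae_bsIntensity_pos

lemma ae_exists_forall_equivDist_le : ∀ᵐ ω ∂P₀, ∃ n, ∀ m,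
    N.equivDist ‖(Φb n ω).1‖ (Φb n ω).2 ≤ N.equivDist ‖(Φb m ω).1‖ (Φb m ω).2 := by
  have hcount : ∀ᵐ ω ∂P₀, ∀ k : ℕ, pointCount Φb {p | N.equivDist ‖p.1‖ p.2 ≤ k} ω ≠ ∞ :=
    ae_all_iff.2 fun k => hb.ae_pointCount_ne_top (N.measurableSet_equivDist_norm_le k)
      (by rw [bsIntensity_equivDist_le]; exact ENNReal.ofReal_ne_top)
  filter_upwards [hcount] with ω hω
  obtain ⟨k, hk⟩ := exists_nat_ge (N.equivDist ‖(Φb 0 ω).1‖ (Φb 0 ω).2)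
  obtain ⟨n, hn, hmin⟩ := Set.exists_min_image _
    (fun n => N.equivDist ‖(Φb n ω).1‖ (Φb n ω).2) (finite_of_pointCount_ne_top (hω k)) ⟨0, hk⟩
  refine ⟨n, fun m => ?_⟩
  by_cases hmk : N.equivDist ‖(Φb m ω).1‖ (Φb m ω).2 ≤ k
  · exact hmin m hmk
  · exact le_trans hn (not_le.1 hmk).le

lemma ae_nearestDist_le : ∀ᵐ ω ∂P₀, ∀ n,
    N.nearestDist Φb ω ≤ N.equivDist ‖(Φb n ω).1‖ (Φb n ω).2 := by
  filter_upwards [ae_exists_forall_equivDist_le hb, ae_forall_pos hb] with ω ⟨n, hn⟩ hpos m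
  have hiff (i j : ℕ) := downlinkPower_le_downlinkPower_iff (N := N)
    (hpos i).1 (hpos i).2 (hpos j).1 (hpos j).2
  have hne : {n | ∀ m, N.downlinkPower ‖(Φb m ω).1‖ (Φb m ω).2
      ≤ N.downlinkPower ‖(Φb n ω).1‖ (Φb n ω).2}.Nonempty :=
    ⟨n, fun m => (hiff m n).2 (hn m)⟩
  exact (hiff m _).1 (Nat.sInf_mem hne m)

lemma measure_lt_nearestDist (r : ℝ) : P₀ {ω | r < N.nearestDist Φb ω}
    = ENNReal.ofReal (Real.exp (-N.nearestRate * (max r 0) ^ 2)) := by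
  have hrate := N.nearestRate_pos
  have hvoid : {ω | r < N.nearestDist Φb ω}
      =ᵐ[P₀] {ω | pointCount Φb {p | N.equivDist ‖p.1‖ p.2 ≤ r} ω = 0} := by
    filter_upwards [ae_nearestDist_le hb] with ω hω
    refine propext ?_
    change r < N.nearestDist Φb ω ↔ pointCount Φb _ ω = 0
    rw [pointCount, Measure.count_eq_zero_iff, eq_empty_iff_forall_notMem]
    exact ⟨fun hlt n hn => (hlt.trans_le (hω n)).not_ge hn, fun hempty => not_le.1 (hempty _)⟩
  rw [measure_congr hvoid, hb.measure_pointCount_eq_zero (N.measurableSet_equivDist_norm_le r)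
    (by rw [bsIntensity_equivDist_le]; exact ENNReal.ofReal_ne_top), bsIntensity_equivDist_le,
    ENNReal.toReal_ofReal (by positivity), neg_mul]

lemma map_nearestDist : P₀.map (N.nearestDist Φb) = rayleighMeasure N.nearestRate := by
  have hmeas := N.measurable_nearestDist hb.measurable
  have := hb.isProbabilityMeasure
  have := Measure.isProbabilityMeasure_map (μ := P₀) hmeas.aemeasurable
  refine measure_ext_of_Iic_of_ne_top (fun r => measure_ne_top _ _) fun r => ?_
  rw [rayleighMeasure_Iic N.nearestRate_pos.le, ← compl_Ioi,
    prob_compl_eq_one_sub measurableSet_Ioi, Measure.map_apply hmeas measurableSet_Ioi]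
  change 1 - P₀ {ω | r < N.nearestDist Φb ω} = _
  rw [measure_lt_nearestDist hb, ENNReal.ofReal_sub _ (Real.exp_pos _).le, ENNReal.ofReal_one]

lemma cellularEvent_ae_eq : N.cellularEvent Φb =ᵐ[P₀] N.nearestDist Φb ⁻¹' Iio N.cellRadius := by
  filter_upwards [ae_nearestDist_le hb, ae_forall_pos hb] with ω hnearest hpos
  refine propext ?_
  change ENNReal.ofReal N.β < _ ↔ N.nearestDist Φb ω < N.cellRadius
  have hiff (n : ℕ) :
      ENNReal.ofReal N.β < ENNReal.ofReal (N.downlinkPower ‖(Φb n ω).1‖ (Φb n ω).2) ↔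
        N.equivDist ‖(Φb n ω).1‖ (Φb n ω).2 < N.cellRadius := by
    rw [ENNReal.ofReal_lt_ofReal_iff_of_nonneg N.β_pos.le, ← not_le, ← not_le,
      downlinkPower_le_β_iff (hpos n).1 (hpos n).2]
  simp_rw [lt_iSup_iff, hiff]
  exact ⟨fun ⟨n, hn⟩ => (hnearest n).trans_lt hn, fun h => ⟨_, h⟩⟩

lemma measure_cellularEvent : P₀ (N.cellularEvent Φb)
    = ENNReal.ofReal (1 - Real.exp (-N.nearestRate * N.cellRadius ^ 2)) := by
  rw [measure_congr (cellularEvent_ae_eq hb),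
    ← Measure.map_apply (N.measurable_nearestDist hb.measurable) measurableSet_Iio,
    map_nearestDist hb, rayleighMeasure_Iio N.nearestRate_pos.le, max_eq_left N.cellRadius_pos.le]

omit hb in
lemma exp_neg_nearestRate_mul_lt_one : Real.exp (-N.nearestRate * N.cellRadius ^ 2) < 1 := by
  rw [Real.exp_lt_one_iff, neg_mul]
  exact neg_neg_of_pos (mul_pos N.nearestRate_pos (pow_pos N.cellRadius_pos 2))

lemma cellularProb_lt_one : N.cellularProb Φb P₀ < 1 := by
  rw [cellularProb, Measure.real, measure_cellularEvent hb,
    ENNReal.toReal_ofReal (by linarith [exp_neg_nearestRate_mul_lt_one (N := N)])]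
  linarith [Real.exp_pos (-N.nearestRate * N.cellRadius ^ 2)]

omit hb in
lemma cellRadius_sq : N.cellRadius ^ 2 = (N.A * N.PB / N.β) ^ (2 / N.α) := by
  have := N.PB_pos
  have := N.A_pos
  have := N.β_pos
  rw [cellRadius, ← Real.rpow_mul_natCast (by positivity), ← inv_div N.β,
    Real.inv_rpow (by positivity), ← Real.rpow_neg (by positivity)]
  congr 1
  push_cast
  ring

omit hb in
lemma servingPdf_eq (r : ℝ) : N.servingPdf r =
    (1 - Real.exp (-N.nearestRate * N.cellRadius ^ 2))⁻¹ *
      (2 * N.nearestRate * r * Real.exp (-N.nearestRate * r ^ 2)) := by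
  rw [servingPdf, cellRadius_sq, Real.exp_add, nearestRate, fadingScale, div_eq_inv_mul,
    show -Real.pi * N.lamB * r ^ 2 * Real.exp (2 * N.σ ^ 2 / N.α ^ 2)
      = -(Real.pi * N.lamB * Real.exp (2 * N.σ ^ 2 / N.α ^ 2)) * r ^ 2 by ring,
    show -Real.pi * N.lamB * (N.A * N.PB / N.β) ^ (2 / N.α) * Real.exp (2 * N.σ ^ 2 / N.α ^ 2)
      = -(Real.pi * N.lamB * Real.exp (2 * N.σ ^ 2 / N.α ^ 2)) *
        (N.A * N.PB / N.β) ^ (2 / N.α) by ring]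
  ring

variable (N) in
/-- The law of the equivalent serving distance of a cellular user: the law of the smallest
equivalent distance, conditioned to be at most the cell radius. -/
noncomputable def servingDistLaw : Measure ℝ :=
  (volume.restrict (Ioc 0 N.cellRadius)).withDensity (fun r => ENNReal.ofReal (N.servingPdf r))

omit hb in
lemma smul_rayleighMeasure_restrict_Iio :
    (ENNReal.ofReal (1 - Real.exp (-N.nearestRate * N.cellRadius ^ 2)))⁻¹ •
      (rayleighMeasure N.nearestRate).restrict (Iio N.cellRadius) = N.servingDistLaw := by
  have hlt := exp_neg_nearestRate_mul_lt_one (N := N)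
  rw [rayleighMeasure, restrict_withDensity measurableSet_Iio,
    Measure.restrict_restrict measurableSet_Iio, inter_comm, Ioi_inter_Iio,
    Measure.restrict_congr_set Ioo_ae_eq_Ioc, ← withDensity_smul _ (by fun_prop), servingDistLaw]
  congr 1
  ext r
  rw [Pi.smul_apply, smul_eq_mul, servingPdf_eq, ← ENNReal.ofReal_inv_of_pos (by linarith),
    ← ENNReal.ofReal_mul (inv_nonneg.2 (by linarith))]

lemma map_equivDist_servingLaw :
    (N.servingLaw Φb P₀).map (fun l => N.equivDist l.1 l.2) = N.servingDistLaw := by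
  rw [servingLaw, Measure.map_map N.measurable_equivDist (N.measurable_servingLink hb.measurable)]
  change (ProbabilityTheory.cond P₀ (N.cellularEvent Φb)).map (N.nearestDist Φb) = _
  rw [ProbabilityTheory.cond, Measure.restrict_congr_set (cellularEvent_ae_eq hb),
    Measure.map_smul,
    ← Measure.restrict_map (N.measurable_nearestDist hb.measurable) measurableSet_Iio,
    map_nearestDist hb, measure_cellularEvent hb, smul_rayleighMeasure_restrict_Iio]

lemma ae_servingLaw_pos : ∀ᵐ l ∂N.servingLaw Φb P₀, 0 < l.1 ∧ 0 < l.2 := by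
  have hm : MeasurableSet {l : ℝ × ℝ | 0 < l.1 ∧ 0 < l.2} :=
    (measurableSet_lt measurable_const measurable_fst).inter
      (measurableSet_lt measurable_const measurable_snd)
  rw [servingLaw, ae_map_iff (N.measurable_servingLink hb.measurable).aemeasurable hm]
  exact cond_absolutelyContinuous.ae_le ((ae_forall_pos hb).mono fun ω hω => hω _)

end ServingDistance

end Network

section Inversion

variable {μ : Measure ℝ} [IsFiniteMeasure μ]

lemma norm_inversionKernel_le {T : ℝ} (hT : 0 < T) (w : ℝ) :
    ‖inversionKernel T w‖ ≤ 1 / (2 * Real.pi * T) := by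
  rcases eq_or_ne w 0 with rfl | hw
  · simp only [inversionKernel, Complex.ofReal_zero, mul_zero, div_zero, norm_zero]
    positivity
  · have hcast : Complex.I * (w : ℂ) / T = Complex.I * ((w / T : ℝ) : ℂ) := by
      push_cast
      ring
    rw [inversionKernel, norm_div, div_le_iff₀ (by simp [hw]), hcast]
    refine Real.norm_exp_I_mul_ofReal_sub_one_le.trans_eq ?_
    simp only [norm_mul, norm_div, Complex.norm_I, Complex.norm_real, Real.norm_eq_abs,
      abs_of_pos hT, abs_of_pos Real.pi_pos, Complex.norm_ofNat, mul_one]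
    field_simp

@[fun_prop]
lemma measurable_inversionKernel (T : ℝ) : Measurable (inversionKernel T) := by
  unfold inversionKernel
  fun_prop

lemma tendsto_sinc_mul_atTop (x : ℝ) :
    Tendsto (fun r : ℝ => Real.sinc (r * x)) atTop (𝓝 (({0} : Set ℝ).indicator 1 x)) := by
  rcases eq_or_ne x 0 with rfl | hx
  · simp
  · rw [indicator_of_notMem (by simpa using hx)]
    refine squeeze_zero_norm' (a := fun r : ℝ => |x|⁻¹ * r⁻¹) ?_
      (by simpa using tendsto_inv_atTop_zero.const_mul |x|⁻¹)
    filter_upwards [eventually_gt_atTop 0] with r hr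
    rw [Real.sinc_of_ne_zero (by positivity), norm_div, Real.norm_eq_abs, Real.norm_eq_abs,
      abs_mul, abs_of_pos hr, ← mul_inv, mul_comm |x|, ← one_div]
    gcongr
    exact Real.abs_sin_le_one _

lemma tendsto_average_charFun :
    Tendsto (fun r : ℝ => ((2 * r : ℝ) : ℂ)⁻¹ * ∫ t in -r..r, charFun μ t) atTop
      (𝓝 (μ.real {0} : ℂ)) := by
  have hsinc : Tendsto (fun r : ℝ => ∫ x, Real.sinc (r * x) ∂μ) atTop (𝓝 (μ.real {0})) := by
    rw [← integral_indicator_one (measurableSet_singleton 0)]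
    exact tendsto_integral_filter_of_dominated_convergence (fun _ => 1)
      (Eventually.of_forall fun r => by fun_prop)
      (Eventually.of_forall fun r => ae_of_all _ fun x => Real.abs_sinc_le_one _)
      (integrable_const _) (ae_of_all _ tendsto_sinc_mul_atTop)
  refine (Complex.continuous_ofReal.continuousAt.tendsto.comp hsinc).congr' ?_
  filter_upwards [eventually_gt_atTop 0] with r hr
  have hr' : ((2 * r : ℝ) : ℂ) ≠ 0 := by exact_mod_cast (by positivity : 2 * r ≠ 0)
  rw [integral_charFun_Icc hr, Function.comp_apply, eq_inv_mul_iff_mul_eq₀ hr']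
  push_cast
  rfl

lemma measure_singleton_zero_of_integrable_charFun (hφ : Integrable (charFun μ)) :
    μ {0} = 0 := by
  have hzero : Tendsto (fun r : ℝ => ((2 * r : ℝ) : ℂ)⁻¹ * ∫ t in -r..r, charFun μ t) atTop
      (𝓝 0) := by
    have hinv : Tendsto (fun r : ℝ => (2 * r)⁻¹) atTop (𝓝 0) :=
      tendsto_inv_atTop_zero.comp (tendsto_id.const_mul_atTop two_pos)
    refine squeeze_zero_norm' (a := fun r : ℝ => (2 * r)⁻¹ * ∫ t, ‖charFun μ t‖) ?_
      (by simpa using hinv.mul_const _)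
    filter_upwards [eventually_gt_atTop 0] with r hr
    rw [norm_mul, norm_inv, Complex.norm_real, Real.norm_of_nonneg (by positivity)]
    gcongr
    exact intervalIntegral.norm_integral_le_integral_norm_uIoc.trans
      (setIntegral_le_integral hφ.norm (ae_of_all _ fun _ => norm_nonneg _))
  have hreal := tendsto_nhds_unique tendsto_average_charFun hzero
  rwa [Complex.ofReal_eq_zero, measureReal_eq_zero_iff] at hreal

lemma nullSingletonClass_of_integrable_charFun (hφ : Integrable (charFun μ)) :
    NullSingletonClass μ where
  measure_singleton a := by
    have hshift : Integrable (charFun (μ.map (· + -a))) := by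
      refine hφ.mono (by fun_prop) (ae_of_all _ fun t => ?_)
      rw [charFun_map_add_const, norm_mul, Complex.norm_exp_ofReal_mul_I, mul_one]
    have hpre : (· + -a) ⁻¹' ({0} : Set ℝ) = {a} := by
      ext x
      simp [← sub_eq_add_neg, sub_eq_zero]
    rw [← hpre, ← Measure.map_apply (by fun_prop) (measurableSet_singleton 0)]
    exact measure_singleton_zero_of_integrable_charFun hshift

lemma integrable_prod_comp_sub {g : ℝ → ℂ} (hg : Integrable g) :
    Integrable (fun p : ℝ × ℝ => g (p.1 - p.2)) (volume.prod μ) := by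
  have hmeas : AEStronglyMeasurable (fun p : ℝ × ℝ => g (p.1 - p.2)) (volume.prod μ) :=
    hg.aestronglyMeasurable.comp_quasiMeasurePreserving
      (quasiMeasurePreserving_sub_of_right_invariant volume μ)
  rw [integrable_prod_iff' hmeas]
  exact ⟨ae_of_all _ fun x => hg.comp_sub_right x, by
    simp only [integral_sub_right_eq_self fun v => ‖g v‖, integrable_const]⟩

open FourierTransform in
lemma fourier_integral_comp_sub {g : ℝ → ℂ} (hg : Integrable g) (ξ : ℝ) :
    𝓕 (fun v => ∫ x, g (v - x) ∂μ) ξ = 𝓕 g ξ * charFun μ (-(2 * Real.pi * ξ)) := by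
  simp only [Real.fourier_real_eq_integral_exp_smul, smul_eq_mul, charFun_apply_real]
  simp_rw [← integral_const_mul]
  rw [integral_integral_swap]
  · refine integral_congr_ae (ae_of_all _ fun x => ?_)
    dsimp only
    rw [← integral_sub_right_eq_self (μ := volume) _ (-x), ← integral_mul_const]
    refine integral_congr_ae (ae_of_all _ fun v => ?_)
    dsimp only
    rw [sub_neg_eq_add, add_sub_cancel_right, mul_right_comm (Complex.exp _),
      ← Complex.exp_add]
    congr 2
    push_cast
    ring
  · refine (integrable_prod_comp_sub (μ := μ) hg).mono (.mul (by fun_prop)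
      (integrable_prod_comp_sub hg).aestronglyMeasurable) (ae_of_all _ fun p => ?_)
    simp only [Function.uncurry]
    rw [norm_mul, Complex.norm_exp_ofReal_mul_I, one_mul]

open FourierTransform in
lemma fourier_indicator_Ioo_eq_inversionKernel {T ξ : ℝ} (hT : 0 < T) (hξ : ξ ≠ 0) :
    𝓕 ((Ioo (-(1 / T)) 0).indicator fun _ => (1 : ℂ)) ξ
      = 2 * Real.pi * inversionKernel T (2 * Real.pi * ξ) := by
  have hξ' : (ξ : ℂ) ≠ 0 := by exact_mod_cast hξ
  have hπ : (Real.pi : ℂ) ≠ 0 := by exact_mod_cast Real.pi_ne_zero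
  have hc : -2 * Real.pi * ξ * Complex.I ≠ 0 := by simp [hξ, Real.pi_ne_zero]
  calc 𝓕 ((Ioo (-(1 / T)) 0).indicator fun _ => (1 : ℂ)) ξ
      = ∫ v, (Ioo (-(1 / T)) 0).indicator
          (fun v : ℝ => Complex.exp (-2 * Real.pi * ξ * Complex.I * v)) v := by
        rw [Real.fourier_real_eq_integral_exp_smul]
        refine integral_congr_ae (ae_of_all _ fun v => ?_)
        simp only [indicator_apply, smul_eq_mul, mul_ite, mul_one, mul_zero]
        push_cast
        ring_nf
    _ = ∫ v in -(1 / T)..0, Complex.exp (-2 * Real.pi * ξ * Complex.I * v) := by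
        rw [integral_indicator measurableSet_Ioo, ← integral_Ioc_eq_integral_Ioo,
          intervalIntegral.integral_of_le (by simp [hT.le])]
    _ = 2 * Real.pi * inversionKernel T (2 * Real.pi * ξ) := by
        rw [integral_exp_mul_complex hc, inversionKernel]
        push_cast
        rw [mul_zero, Complex.exp_zero,
          show -2 * Real.pi * ξ * Complex.I * -(1 / T) = Complex.I * (2 * Real.pi * ξ) / T by ring]
        field_simp
        ring

lemma continuousAt_integral_indicator_Ioo_comp_sub [NullSingletonClass μ] (a b v : ℝ) :
    ContinuousAt (fun v => ∫ x, (Ioo a b).indicator (fun _ => (1 : ℂ)) (v - x) ∂μ) v := by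
  refine continuousAt_of_dominated (bound := fun _ => 1) ?_ ?_ (integrable_const _) ?_
  · exact Eventually.of_forall fun v =>
      ((measurable_const.indicator measurableSet_Ioo).comp
        (measurable_const.sub measurable_id)).aestronglyMeasurable
  · refine Eventually.of_forall fun v => ae_of_all _ fun x => ?_
    exact (norm_indicator_le_norm_self _ _).trans (by simp)
  · have hne (c : ℝ) : ∀ᵐ x ∂μ, v - x ≠ c := by
      filter_upwards [compl_mem_ae_iff.2 (measure_singleton (v - c))] with x hx hc
      exact hx (by rw [mem_singleton_iff]; linarith)
    filter_upwards [hne a, hne b] with x ha hb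
    have hfrontier : v - x ∉ frontier (Ioo a b) := fun h => by
      rcases lt_or_ge a b with hab | hab
      · rw [frontier_Ioo hab] at h
        exact h.elim ha hb
      · simp [Ioo_eq_empty hab.not_gt] at h
    exact ContinuousAt.comp (f := fun v => v - x)
      (continuousOn_const.continuousAt_indicator hfrontier) (by fun_prop)

lemma integrable_inversionKernel_mul {φ : ℝ → ℂ} (hφ : Integrable φ) {T : ℝ} (hT : 0 < T) :
    Integrable fun w => inversionKernel T w * φ w :=
  hφ.bdd_mul (measurable_inversionKernel T).aestronglyMeasurable
    (ae_of_all _ (norm_inversionKernel_le hT))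

open FourierTransform in
theorem measureReal_Ioo_eq_integral_inversionKernel (hφ : Integrable (charFun μ))
    {T : ℝ} (hT : 0 < T) :
    (μ.real (Ioo 0 (1 / T)) : ℂ) = ∫ w : ℝ, inversionKernel T w * charFun μ (-w) := by
  have := nullSingletonClass_of_integrable_charFun hφ
  set g : ℝ → ℂ := (Ioo (-(1 / T)) 0).indicator fun _ => 1
  set F : ℝ → ℂ := fun v => ∫ x, g (v - x) ∂μ
  have hg : Integrable g := (integrable_indicator_iff measurableSet_Ioo).2
    (integrableOn_const measure_Ioo_lt_top.ne)
  have hF : Integrable F := (integrable_prod_comp_sub hg).integral_prod_left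
  have h2π : (2 * Real.pi : ℝ) ≠ 0 := by positivity
  have hfourier : 𝓕 F =ᵐ[volume] fun ξ => (2 * Real.pi : ℝ) •
      (inversionKernel T (2 * Real.pi * ξ) * charFun μ (-(2 * Real.pi * ξ))) := by
    filter_upwards [compl_mem_ae_iff.2 (measure_singleton (0 : ℝ))] with ξ hξ
    rw [fourier_integral_comp_sub hg, fourier_indicator_Ioo_eq_inversionKernel hT hξ,
      Complex.real_smul, Complex.ofReal_mul, Complex.ofReal_ofNat, mul_assoc]
  have hintegrable : Integrable (𝓕 F) :=
    (((integrable_inversionKernel_mul hφ.comp_neg hT).comp_mul_left' h2π).smul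
      (2 * Real.pi : ℝ)).congr hfourier.symm
  have hF0 : F 0 = μ.real (Ioo 0 (1 / T)) := by
    have hreflect : (fun x => g (0 - x)) = (Ioo 0 (1 / T)).indicator fun _ => (1 : ℂ) := by
      ext x
      simp only [g, indicator_apply, mem_Ioo, zero_sub, neg_lt_neg_iff, neg_lt_zero, and_comm]
    simp only [F, hreflect, integral_indicator_const _ measurableSet_Ioo, Complex.real_smul,
      mul_one]
  calc (μ.real (Ioo 0 (1 / T)) : ℂ) = 𝓕⁻ (𝓕 F) 0 := by
        rw [hF.fourierInv_fourier_eq hintegrable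
          (continuousAt_integral_indicator_Ioo_comp_sub _ _ 0), hF0]
    _ = ∫ ξ, 𝓕 F ξ := by simp [Real.fourierInv_eq']
    _ = ∫ w, inversionKernel T w * charFun μ (-w) := by
        rw [integral_congr_ae hfourier, integral_smul, Measure.integral_comp_mul_left
          (fun w => inversionKernel T w * charFun μ (-w)) (2 * Real.pi), smul_smul, abs_inv,
          abs_of_pos (by positivity), mul_inv_cancel₀ h2π, one_smul]

theorem measureReal_Iio_eq_integral_inversionKernel (hneg : μ (Iio 0) = 0)
    (hφ : Integrable (charFun μ)) {T : ℝ} (hT : 0 < T) :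
    (μ.real (Iio (1 / T)) : ℂ) = ∫ w : ℝ, inversionKernel T w * charFun μ (-w) := by
  have := nullSingletonClass_of_integrable_charFun hφ
  have hpos : ∀ᵐ x ∂μ, 0 < x := by
    simp only [ae_iff, not_lt]
    exact (measure_congr Iio_ae_eq_Iic).symm.trans hneg
  rw [← measureReal_Ioo_eq_integral_inversionKernel hφ hT]
  congr 1
  refine measureReal_congr ?_
  filter_upwards [hpos] with x hx
  exact propext ⟨fun h => ⟨hx, h⟩, And.right⟩

end Inversion

section Radial

variable {c : ℝ} {E : Type*} [NormedAddCommGroup E] [NormedSpace ℝ E]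

instance sigmaFinite_radialMeasure (c : ℝ) : SigmaFinite (radialMeasure c) :=
  SigmaFinite.withDensity_ofReal _

lemma integrable_radialMeasure_iff (hc : 0 < c) {f : ℝ → E} :
    Integrable f (radialMeasure c) ↔ IntegrableOn (fun τ => τ • f τ) (Ioi 0) := by
  have hne : (2 * Real.pi * c : ℝ) ≠ 0 := by positivity
  rw [radialMeasure, integrable_withDensity_iff_integrable_smul' (by fun_prop)
    (ae_of_all _ fun x => ENNReal.ofReal_lt_top), IntegrableOn,
    ← integrable_smul_iff hne fun τ : ℝ => τ • f τ]
  refine integrable_congr ?_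
  filter_upwards [ae_restrict_mem measurableSet_Ioi] with τ hτ
  have hτ' : (0 : ℝ) < τ := hτ
  rw [ENNReal.toReal_ofReal (by positivity), Pi.smul_apply, mul_smul]

lemma integral_radialMeasure (hc : 0 < c) (f : ℝ → E) :
    ∫ τ, f τ ∂radialMeasure c = (2 * Real.pi * c) • ∫ τ in Ioi (0 : ℝ), τ • f τ := by
  rw [radialMeasure, integral_withDensity_eq_integral_toReal_smul (by fun_prop)
    (ae_of_all _ fun x => ENNReal.ofReal_lt_top), ← integral_smul]
  refine setIntegral_congr_fun measurableSet_Ioi fun τ hτ => ?_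
  have hτ' : (0 : ℝ) < τ := hτ
  simp only [ENNReal.toReal_ofReal (by positivity : 0 ≤ 2 * Real.pi * c * τ), mul_smul]

lemma integral_radialMeasure_of_eq_zero (hc : 0 < c) {f : ℝ → E} {t : ℝ} (ht : 0 < t)
    (hf : ∀ τ < t, f τ = 0) :
    ∫ τ, f τ ∂radialMeasure c = (2 * Real.pi * c) • ∫ τ in Ioi t, τ • f τ := by
  rw [integral_radialMeasure hc, ← integral_Ici_eq_integral_Ioi (x := t)]
  congr 1
  refine setIntegral_eq_of_subset_of_forall_sdiff_eq_zero measurableSet_Ioi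
    (Ici_subset_Ioi.2 ht) fun x hx => ?_
  rw [hf x (not_le.1 hx.2), smul_zero]

end Radial

section ShotNoise

variable {Ω E : Type*}

/-- The shot noise `∑ f (x n)` of a configuration of points, for a response function `f` that is
meant to be nonnegative; it takes values in `[0, ∞]` so that the sum always exists. -/
noncomputable def shotNoise (f : E → ℝ) (x : ℕ → E) : ℝ≥0∞ :=
  ∑' n, ENNReal.ofReal (f (x n))

variable [MeasurableSpace Ω] [MeasurableSpace E]

@[fun_prop]
lemma measurable_shotNoise {f : E → ℝ} (hf : Measurable f) : Measurable (shotNoise f) :=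
  .tsum fun n => (hf.comp (measurable_pi_apply n)).ennreal_ofReal

namespace IsPoissonProcess

variable {X : ℕ → Ω → E} {Λ : Measure E} {P : Measure Ω} (hX : IsPoissonProcess X Λ P)
include hX

lemma measurable_config : Measurable fun ω n => X n ω :=
  measurable_pi_lambda _ hX.measurable

variable [SigmaFinite Λ] {f : E → ℝ} (hf : Measurable f) (hfi : Integrable f Λ)
include hf hfi

lemma ae_shotNoise_ne_top : ∀ᵐ ω ∂P, shotNoise f (fun n => X n ω) ≠ ∞ := by
  have hmean : ∫⁻ ω, shotNoise f (fun n => X n ω) ∂P ≠ ∞ := by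
    simp only [shotNoise]
    rw [hX.lintegral_tsum_eq (g := fun x => ENNReal.ofReal (f x)) hf.ennreal_ofReal]
    exact hfi.lintegral_lt_top.ne
  exact (ae_lt_top ((measurable_shotNoise hf).comp hX.measurable_config) hmean).mono
    fun _ h => h.ne

omit hf hfi in
lemma ae_toReal_shotNoise (hnn : 0 ≤ᵐ[Λ] f) :
    ∀ᵐ ω ∂P, (shotNoise f (fun n => X n ω)).toReal = ∑' n, f (X n ω) := by
  filter_upwards [hX.ae_forall_of_ae hnn] with ω hω
  rw [shotNoise, ENNReal.tsum_toReal_eq fun n => ENNReal.ofReal_ne_top]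
  exact tsum_congr fun n => ENNReal.toReal_ofReal (hω n)

lemma charFun_shotNoise (hnn : 0 ≤ᵐ[Λ] f) (u : ℝ) :
    charFun (P.map fun ω => (shotNoise f fun n => X n ω).toReal) u
      = Complex.exp (∫ x, (Complex.exp (Complex.I * ((u * f x : ℝ) : ℂ)) - 1) ∂Λ) := by
  have hm : Measurable fun ω => (shotNoise f fun n => X n ω).toReal :=
    ((measurable_shotNoise hf).comp hX.measurable_config).ennreal_toReal
  rw [← hX.integral_exp_tsum (g := fun x => u * f x) (hf.const_mul u) (hfi.const_mul u),
    charFun_apply_real, integral_map hm.aemeasurable (by fun_prop)]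
  refine integral_congr_ae ?_
  filter_upwards [hX.ae_toReal_shotNoise hnn] with ω hω
  rw [hω, tsum_mul_left]
  push_cast
  ring_nf

end IsPoissonProcess

end ShotNoise

namespace Network

variable (N : Network)

section Marked

variable {M : Type*} [MeasurableSpace M] (c : ℝ) (m : Measure M)

/-- Intensity of a process of users of density `c` in the plane, each marked with its fading
towards the typical base station and with an independent mark of law `m`. -/
noncomputable def markedIntensity : Measure ((Plane × ℝ) × M) :=
  (ENNReal.ofReal c • (volume : Measure Plane).prod N.fadingLaw).prod m

/-- Interference received over an equivalent distance `p.1` from a user whose transmit power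
contributes the factor `p.2`; users within the cell radius do not interfere. -/
noncomputable def radialResponse (p : ℝ × ℝ) : ℝ :=
  if N.cellRadius ≤ p.1 then p.2 * p.1 ^ (-N.α) else 0

/-- Interference from a marked user whose transmit power is determined by its mark via `a`. -/
noncomputable def response (a : M → ℝ) (p : (Plane × ℝ) × M) : ℝ :=
  N.radialResponse (N.equivDist ‖p.1.1‖ p.1.2, a p.2)

/-- The radial integrand in the exponent of the characteristic function, at `u`, of the
interference from users whose power factors have law `μ`. -/
noncomputable def radialIntegrand (μ : Measure ℝ) (u τ : ℝ) : ℂ :=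
  (1 - charFun μ (u * τ ^ (-N.α))) * τ

instance sigmaFinite_smul_prod_fadingLaw :
    SigmaFinite (ENNReal.ofReal c • (volume : Measure Plane).prod N.fadingLaw) :=
  inferInstanceAs (SigmaFinite (Real.toNNReal c • (volume : Measure Plane).prod N.fadingLaw))

instance sigmaFinite_markedIntensity [SigmaFinite m] : SigmaFinite (N.markedIntensity c m) := by
  unfold markedIntensity
  infer_instance

lemma measurePreserving_markedIntensity [SFinite m] {a : M → ℝ} (ha : Measurable a) :
    MeasurePreserving (fun p : (Plane × ℝ) × M => (N.equivDist ‖p.1.1‖ p.1.2, a p.2))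
      (N.markedIntensity c m)
      (ENNReal.ofReal c • (radialMeasure N.fadingScale).prod (m.map a)) where
  measurable := by fun_prop
  map_eq := by
    rw [markedIntensity, Measure.prod_smul_left, Measure.map_smul, ← N.map_equivDist,
      Measure.map_prod_map _ _ (by fun_prop) ha]
    rfl

@[fun_prop]
lemma measurable_radialResponse : Measurable N.radialResponse := by
  unfold radialResponse
  exact Measurable.ite (measurableSet_le measurable_const measurable_fst) (by fun_prop)
    measurable_const

omit [MeasurableSpace M] in
lemma response_nonneg {a : M → ℝ} {p : (Plane × ℝ) × M} (ha : 0 ≤ a p.2) :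
    0 ≤ N.response a p := by
  rw [response, radialResponse]
  split_ifs with h
  · exact mul_nonneg ha (Real.rpow_nonneg (N.cellRadius_pos.le.trans h) _)
  · exact le_rfl

lemma integrable_radialResponse {μ : Measure ℝ} (hμ : Integrable id μ) :
    Integrable N.radialResponse ((radialMeasure N.fadingScale).prod μ) := by
  have hα := N.two_lt_α
  have hpow : IntegrableOn (fun τ : ℝ => τ ^ (1 - N.α)) (Ici N.cellRadius) := by
    rw [integrableOn_Ici_iff_integrableOn_Ioi]
    exact integrableOn_Ioi_rpow_of_lt (by linarith) N.cellRadius_pos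
  have hradial : Integrable ((Ici N.cellRadius).indicator fun τ : ℝ => τ ^ (-N.α))
      (radialMeasure N.fadingScale) := by
    rw [integrable_radialMeasure_iff N.fadingScale_pos]
    refine ((integrable_indicator_iff measurableSet_Ici).2 hpow).integrableOn.congr_fun
      (fun τ hτ => ?_) measurableSet_Ioi
    simp only [indicator_apply, smul_eq_mul, mul_ite, mul_zero, sub_eq_add_neg,
      Real.rpow_add (mem_Ioi.1 hτ), Real.rpow_one]
  refine (hradial.mul_prod hμ).congr (ae_of_all _ fun p => ?_)
  simp only [radialResponse, indicator_apply, mem_Ici, ite_mul, zero_mul, id, mul_comm p.2]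

lemma integrable_response [SFinite m] {a : M → ℝ} (ha : Measurable a)
    (hi : Integrable a m) : Integrable (N.response a) (N.markedIntensity c m) :=
  (N.measurePreserving_markedIntensity c m ha).integrable_comp_of_integrable
    ((N.integrable_radialResponse
      ((integrable_map_measure (by fun_prop) ha.aemeasurable).2 hi)).smul_measure
        ENNReal.ofReal_ne_top)

lemma integral_exp_radialResponse {μ : Measure ℝ} [IsProbabilityMeasure μ] (u τ : ℝ) :
    τ • ∫ x, (Complex.exp (Complex.I * ((u * N.radialResponse (τ, x) : ℝ) : ℂ)) - 1) ∂μ =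
      if N.cellRadius ≤ τ then -N.radialIntegrand μ u τ else 0 := by
  unfold radialResponse
  split_ifs with h
  · have hexp : Integrable
        (fun x : ℝ => Complex.exp (Complex.I * ((u * (x * τ ^ (-N.α)) : ℝ) : ℂ))) μ := by
      refine Integrable.of_bound (by fun_prop) 1 (ae_of_all _ fun x => ?_)
      rw [mul_comm, Complex.norm_exp_ofReal_mul_I]
    have hcomm : ∀ x : ℝ, Complex.exp (Complex.I * ((u * (x * τ ^ (-N.α)) : ℝ) : ℂ)) =
        Complex.exp (((u * τ ^ (-N.α) : ℝ) : ℂ) * x * Complex.I) := fun x => by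
      push_cast
      ring_nf
    rw [integral_sub hexp (integrable_const _), radialIntegrand, charFun_apply_real]
    simp only [hcomm, integral_const, probReal_univ, one_smul, Complex.real_smul]
    ring
  · simp

lemma integrable_exp_radialResponse {μ : Measure ℝ} (hμ : Integrable id μ) (u : ℝ) :
    Integrable (fun p => Complex.exp (Complex.I * ((u * N.radialResponse p : ℝ) : ℂ)) - 1)
      ((radialMeasure N.fadingScale).prod μ) :=
  integrable_exp_I_mul_sub_one ((N.integrable_radialResponse hμ).const_mul u)

lemma integrableOn_radialIntegrand {μ : Measure ℝ} [IsProbabilityMeasure μ]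
    (hμ : Integrable id μ) (u : ℝ) :
    IntegrableOn (N.radialIntegrand μ u) (Ioi N.cellRadius) := by
  have hint := (N.integrable_exp_radialResponse hμ u).integral_prod_left
  rw [integrable_radialMeasure_iff N.fadingScale_pos] at hint
  refine (hint.mono_set (Ioi_subset_Ioi N.cellRadius_pos.le)).neg.congr_fun
    (fun τ hτ => ?_) measurableSet_Ioi
  rw [Pi.neg_apply, N.integral_exp_radialResponse, if_pos (le_of_lt hτ), neg_neg]

lemma integral_exp_response [IsProbabilityMeasure m] (hc : 0 ≤ c) {a : M → ℝ}
    (ha : Measurable a) (hi : Integrable a m) (u : ℝ) :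
    ∫ p, (Complex.exp (Complex.I * ((u * N.response a p : ℝ) : ℂ)) - 1) ∂N.markedIntensity c m
      = -((2 * Real.pi * c * N.fadingScale : ℝ) : ℂ) *
        ∫ τ in Ioi N.cellRadius, N.radialIntegrand (m.map a) u τ := by
  have := Measure.isProbabilityMeasure_map (μ := m) ha.aemeasurable
  have hint := N.integrable_exp_radialResponse
    ((integrable_map_measure (by fun_prop) ha.aemeasurable).2 hi) u
  calc ∫ p, (Complex.exp (Complex.I * ((u * N.response a p : ℝ) : ℂ)) - 1)
        ∂N.markedIntensity c m
      = ∫ p, (Complex.exp (Complex.I * ((u * N.radialResponse p : ℝ) : ℂ)) - 1)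
          ∂(ENNReal.ofReal c • (radialMeasure N.fadingScale).prod (m.map a)) := by
        have hmap := N.measurePreserving_markedIntensity c m ha
        rw [← hmap.map_eq, integral_map hmap.measurable.aemeasurable (by fun_prop)]
        rfl
    _ = c • (2 * Real.pi * N.fadingScale) • ∫ τ in Ioi N.cellRadius,
          -N.radialIntegrand (m.map a) u τ := by
        rw [integral_smul_measure, ENNReal.toReal_ofReal hc, integral_prod _ hint,
          integral_radialMeasure_of_eq_zero N.fadingScale_pos N.cellRadius_pos]
        · congr 2
          refine setIntegral_congr_fun measurableSet_Ioi fun τ hτ => ?_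
          simp only [N.integral_exp_radialResponse, if_pos (mem_Ioi.1 hτ).le]
        · intro τ hτ
          simp [radialResponse, not_le.2 hτ]
    _ = -((2 * Real.pi * c * N.fadingScale : ℝ) : ℂ) *
          ∫ τ in Ioi N.cellRadius, N.radialIntegrand (m.map a) u τ := by
        rw [integral_neg, Complex.real_smul, Complex.real_smul]
        push_cast
        ring

end Marked

end Network

lemma integrable_exp_neg_mul_abs_rpow {p b : ℝ} (hp : 0 < p) (hb : 0 < b) :
    Integrable fun w : ℝ => Real.exp (-b * |w| ^ p) := by
  refine .of_integral_ne_zero ?_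
  rw [integral_comp_abs (f := fun w => Real.exp (-b * w ^ p)), integral_exp_neg_mul_rpow hp hb]
  have : 0 < Real.Gamma (1 / p + 1) := Real.Gamma_pos_of_pos (by positivity)
  positivity

lemma mul_rpow_le_one_sub_cos_mul {α b τ : ℝ} (hb : 0 ≤ b) (hτ : 0 < τ) (hbτ : b ≤ τ ^ α) :
    2 / Real.pi ^ 2 * b ^ 2 * τ ^ (1 - 2 * α) ≤ (1 - Real.cos (b * τ ^ (-α))) * τ := by
  have hle : b * τ ^ (-α) ≤ 1 := by
    rw [Real.rpow_neg hτ.le, ← div_eq_mul_inv, div_le_one (Real.rpow_pos_of_pos hτ _)]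
    exact hbτ
  have habs : |b * τ ^ (-α)| ≤ Real.pi := by
    rw [abs_of_nonneg (by positivity)]
    linarith [Real.pi_gt_three]
  have hpow : τ ^ (1 - 2 * α) = (τ ^ (-α)) ^ 2 * τ := by
    rw [sub_eq_neg_add, Real.rpow_add hτ, Real.rpow_one, ← Real.rpow_mul_natCast hτ.le]
    congr 2
    push_cast
    ring
  have hcos := Real.cos_le_one_sub_mul_cos_sq habs
  calc 2 / Real.pi ^ 2 * b ^ 2 * τ ^ (1 - 2 * α)
      = 2 / Real.pi ^ 2 * (b * τ ^ (-α)) ^ 2 * τ := by rw [hpow]; ring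
    _ ≤ (1 - Real.cos (b * τ ^ (-α))) * τ := by gcongr; linarith

lemma integral_Ioi_sq_mul_rpow {α x : ℝ} (hα : 1 < α) (hx : 0 < x) :
    ∫ τ in Ioi x, 2 / Real.pi ^ 2 * (x ^ α) ^ 2 * τ ^ (1 - 2 * α)
      = (Real.pi ^ 2 * (α - 1))⁻¹ * x ^ 2 := by
  have hα1 : α - 1 ≠ 0 := (sub_pos.2 hα).ne'
  have hpow : (x ^ α) ^ 2 * x ^ (1 - 2 * α + 1) = x ^ 2 := by
    rw [← Real.rpow_mul_natCast hx.le, ← Real.rpow_add hx, ← Real.rpow_natCast x 2]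
    congr 1
    push_cast
    ring
  have hden : 1 - 2 * α + 1 = -(2 * (α - 1)) := by ring
  rw [integral_const_mul, integral_Ioi_rpow_of_lt (by linarith) hx, ← hpow, hden]
  field_simp

lemma le_integral_one_sub_cos_mul {α t b : ℝ} (hα : 1 < α) (ht : 0 < t) (hb : 0 ≤ b)
    (hi : IntegrableOn (fun τ : ℝ => (1 - Real.cos (b * τ ^ (-α))) * τ) (Ioi t)) :
    (Real.pi ^ 2 * (α - 1))⁻¹ * (b ^ (2 / α) - t ^ 2)
      ≤ ∫ τ in Ioi t, (1 - Real.cos (b * τ ^ (-α))) * τ := by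
  have hα0 : 0 < α := one_pos.trans hα
  have : 0 < α - 1 := sub_pos.2 hα
  have hnn : ∀ τ ∈ Ioi t, 0 ≤ (1 - Real.cos (b * τ ^ (-α))) * τ := fun τ hτ =>
    mul_nonneg (sub_nonneg.2 (Real.cos_le_one _)) (ht.trans hτ).le
  obtain ⟨x, hx, rfl⟩ : ∃ x, 0 ≤ x ∧ x ^ α = b :=
    ⟨b ^ α⁻¹, by positivity, Real.rpow_inv_rpow hb hα0.ne'⟩
  have hx2 : (x ^ α) ^ (2 / α) = x ^ 2 := by
    rw [← Real.rpow_mul hx, mul_div_cancel₀ _ hα0.ne', Real.rpow_two]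
  rw [hx2]
  rcases lt_or_ge x t with hxt | htx
  · refine le_trans ?_ (setIntegral_nonneg measurableSet_Ioi hnn)
    exact mul_nonpos_of_nonneg_of_nonpos (by positivity) (by nlinarith)
  · have hx0 : 0 < x := ht.trans_le htx
    have hsub : Ioi x ⊆ Ioi t := Ioi_subset_Ioi htx
    have hexp : 1 - 2 * α < -1 := by linarith
    calc (Real.pi ^ 2 * (α - 1))⁻¹ * (x ^ 2 - t ^ 2)
        ≤ (Real.pi ^ 2 * (α - 1))⁻¹ * x ^ 2 := by
          gcongr
          linarith [sq_nonneg t]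
      _ = ∫ τ in Ioi x, 2 / Real.pi ^ 2 * (x ^ α) ^ 2 * τ ^ (1 - 2 * α) :=
          (integral_Ioi_sq_mul_rpow hα hx0).symm
      _ ≤ ∫ τ in Ioi x, (1 - Real.cos (x ^ α * τ ^ (-α))) * τ :=
          setIntegral_mono_on ((integrableOn_Ioi_rpow_of_lt hexp hx0).const_mul _)
            (hi.mono_set hsub) measurableSet_Ioi fun τ hτ =>
              mul_rpow_le_one_sub_cos_mul hb (hx0.trans hτ)
                (Real.rpow_le_rpow hx (le_of_lt hτ) hα0.le)
      _ ≤ ∫ τ in Ioi t, (1 - Real.cos (x ^ α * τ ^ (-α))) * τ :=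
          setIntegral_mono_set hi ((ae_restrict_iff' measurableSet_Ioi).2 (ae_of_all _ hnn))
            hsub.eventuallyLE

namespace Network

variable (N : Network)

/-- Power received by the typical base station from its own user at equivalent distance `r`. -/
noncomputable def signalAt (r : ℝ) : ℝ := N.P0 * N.A ^ (1 - N.ε) * r ^ (N.α * (N.ε - 1))

/-- The factor contributed to the interference from a cellular user by its transmit power and by
the path loss constant, `l` being the (length, fading) of the serving link of that user. -/
noncomputable def cuFactor (l : ℝ × ℝ) : ℝ :=
  N.P0 * N.A ^ (1 - N.ε) * N.equivDist l.1 l.2 ^ (N.α * N.ε)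

/-- The analogue of `cuFactor` for a D2D user; it vanishes for receivers. -/
noncomputable def d2dFactor (b : Bool) : ℝ := if b = true then N.Pd * N.A else 0

/-- What the analysis of the uplink needs to know about the law `ν` of the (length, fading) of the
serving link of a cellular user. -/
structure IsServingLaw (ν : Measure (ℝ × ℝ)) : Prop where
  ae_pos : ∀ᵐ l ∂ν, 0 < l.1 ∧ 0 < l.2
  map_equivDist : ν.map (fun l => N.equivDist l.1 l.2) = N.servingDistLaw

section Interference

lemma signalAt_pos {r : ℝ} (hr : 0 < r) : 0 < N.signalAt r :=
  mul_pos (mul_pos N.P0_pos (Real.rpow_pos_of_pos N.A_pos _)) (Real.rpow_pos_of_pos hr _)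

@[fun_prop]
lemma measurable_signalAt : Measurable N.signalAt := by
  unfold signalAt
  fun_prop

@[fun_prop]
lemma measurable_cuFactor : Measurable N.cuFactor := by
  unfold cuFactor
  fun_prop

@[fun_prop]
lemma measurable_cuInterference : Measurable N.cuInterference := by
  unfold cuInterference uplinkTxPower gain
  exact Measurable.ite (measurableSet_le (by fun_prop) measurable_const) (by fun_prop)
    measurable_const

@[fun_prop]
lemma measurable_d2dInterference : Measurable N.d2dInterference := by
  unfold d2dInterference gain
  have hle : MeasurableSet {p : (Plane × ℝ) × Bool | N.downlinkPower ‖p.1.1‖ p.1.2 ≤ N.β} :=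
    measurableSet_le (by fun_prop) measurable_const
  exact Measurable.ite ((measurable_snd (measurableSet_singleton true)).inter hle) (by fun_prop)
    measurable_const

lemma signal_eq {l : ℝ × ℝ} (hl : 0 < l.1 ∧ 0 < l.2) :
    N.signal l = N.signalAt (N.equivDist l.1 l.2) := by
  have hα : N.α * (N.ε - 1) = N.α * N.ε + -N.α := by ring
  rw [signal, uplinkTxPower_eq hl.1 hl.2, gain_eq hl.1 hl.2, signalAt, hα,
    Real.rpow_add (equivDist_pos hl.1 hl.2), sub_eq_neg_add, Real.rpow_add N.A_pos, Real.rpow_one]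
  ring

lemma cuInterference_eq_response {p : (Plane × ℝ) × (ℝ × ℝ)} (hp : 0 < ‖p.1.1‖ ∧ 0 < p.1.2)
    (hl : 0 < p.2.1 ∧ 0 < p.2.2) : N.cuInterference p = N.response N.cuFactor p := by
  rw [cuInterference, response, radialResponse, uplinkTxPower_eq hl.1 hl.2, gain_eq hp.1 hp.2,
    cuFactor, sub_eq_neg_add, Real.rpow_add N.A_pos, Real.rpow_one]
  simp only [downlinkPower_le_β_iff hp.1 hp.2]
  congr 1
  ring

lemma d2dInterference_eq_response {p : (Plane × ℝ) × Bool} (hp : 0 < ‖p.1.1‖ ∧ 0 < p.1.2) :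
    N.d2dInterference p = N.response N.d2dFactor p := by
  rw [d2dInterference, response, radialResponse, gain_eq hp.1 hp.2, d2dFactor]
  simp only [downlinkPower_le_β_iff hp.1 hp.2, ite_mul, zero_mul, mul_assoc, ← ite_and, and_comm]

lemma ae_markedIntensity_pos {M : Type*} [MeasurableSpace M] (c : ℝ) (m : Measure M) :
    ∀ᵐ p ∂N.markedIntensity c m, 0 < ‖p.1.1‖ ∧ 0 < p.1.2 :=
  Measure.quasiMeasurePreserving_fst.ae (Measure.ae_smul_measure N.ae_pos_pos _)

lemma cuInterference_ae_eq_response {ν : Measure (ℝ × ℝ)} (hν : N.IsServingLaw ν) (c : ℝ) :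
    N.cuInterference =ᵐ[N.markedIntensity c ν] N.response N.cuFactor := by
  filter_upwards [N.ae_markedIntensity_pos c ν, Measure.quasiMeasurePreserving_snd.ae hν.ae_pos]
    with p hp hl
  exact N.cuInterference_eq_response hp hl

lemma d2dInterference_ae_eq_response (c : ℝ) :
    N.d2dInterference =ᵐ[N.markedIntensity c (uniformOn univ)] N.response N.d2dFactor :=
  (N.ae_markedIntensity_pos c _).mono fun _ hp => N.d2dInterference_eq_response hp

lemma cuFactor_nonneg {l : ℝ × ℝ} (hl : 0 < l.1 ∧ 0 < l.2) : 0 ≤ N.cuFactor l := by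
  have := N.P0_pos
  have := N.A_pos
  have := equivDist_pos (N := N) hl.1 hl.2
  unfold cuFactor
  positivity

lemma d2dFactor_nonneg (b : Bool) : 0 ≤ N.d2dFactor b := by
  unfold d2dFactor
  split_ifs
  · exact (mul_pos N.Pd_pos N.A_pos).le
  · exact le_rfl

end Interference

section ServingDistLaw

lemma servingPdf_nonneg {r : ℝ} (hr : 0 ≤ r) : 0 ≤ N.servingPdf r := by
  have hden := sub_pos.2 N.exp_neg_nearestRate_mul_lt_one
  have := N.nearestRate_pos
  rw [servingPdf_eq]
  positivity

lemma continuous_servingPdf : Continuous N.servingPdf := by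
  rw [funext N.servingPdf_eq]
  fun_prop

lemma integral_servingDistLaw (F : ℝ → ℂ) : ∫ r, F r ∂N.servingDistLaw =
    ∫ r in (0 : ℝ)..N.cellRadius, F r * (N.servingPdf r : ℂ) := by
  rw [servingDistLaw, integral_withDensity_eq_integral_toReal_smul
    N.continuous_servingPdf.measurable.ennreal_ofReal (ae_of_all _ fun x => ENNReal.ofReal_lt_top),
    intervalIntegral.integral_of_le N.cellRadius_pos.le]
  refine setIntegral_congr_fun measurableSet_Ioc fun r hr => ?_
  rw [ENNReal.toReal_ofReal (N.servingPdf_nonneg hr.1.le), Complex.real_smul, mul_comm]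

lemma ae_servingDistLaw_mem : ∀ᵐ r ∂N.servingDistLaw, r ∈ Ioc 0 N.cellRadius :=
  (withDensity_absolutelyContinuous _ _).ae_le (ae_restrict_mem measurableSet_Ioc)

lemma isServingLaw_servingLaw {Ω₀ : Type*} [MeasurableSpace Ω₀] {P₀ : Measure Ω₀}
    {Φb : ℕ → Ω₀ → Plane × ℝ} (hb : IsPoissonProcess Φb N.bsIntensity P₀) :
    N.IsServingLaw (N.servingLaw Φb P₀) :=
  ⟨ae_servingLaw_pos hb, map_equivDist_servingLaw hb⟩

end ServingDistLaw

section Exponents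

lemma integrable_cuFactor {ν : Measure (ℝ × ℝ)} [IsFiniteMeasure ν] (hν : N.IsServingLaw ν) :
    Integrable N.cuFactor ν := by
  have hmem : ∀ᵐ l ∂ν, N.equivDist l.1 l.2 ∈ Ioc 0 N.cellRadius :=
    ae_of_ae_map N.measurable_equivDist.aemeasurable (hν.map_equivDist ▸ N.ae_servingDistLaw_mem)
  refine Integrable.of_bound N.measurable_cuFactor.aestronglyMeasurable
    (N.P0 * N.A ^ (1 - N.ε) * N.cellRadius ^ (N.α * N.ε)) ?_
  have hαε : 0 ≤ N.α * N.ε := (mul_pos N.α_pos N.ε_pos).le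
  have := N.P0_pos
  have := N.A_pos
  filter_upwards [hν.ae_pos, hmem] with l hl hd
  rw [Real.norm_of_nonneg (N.cuFactor_nonneg hl), cuFactor]
  gcongr
  exacts [hd.1.le, hd.2]

lemma cuIntegrand_eq {ν : Measure (ℝ × ℝ)} (hν : N.IsServingLaw ν) {r₀ : ℝ} (hr : 0 < r₀)
    (w : ℝ) :
    N.cuIntegrand r₀ w = N.radialIntegrand (ν.map N.cuFactor) (-(w / N.signalAt r₀)) := by
  ext τ
  rw [cuIntegrand, radialIntegrand, ← N.integral_servingDistLaw, ← hν.map_equivDist,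
    integral_map N.measurable_equivDist.aemeasurable (by fun_prop), charFun_apply_real,
    integral_map N.measurable_cuFactor.aemeasurable (by fun_prop)]
  congr 3
  ext l
  congr 1
  have hP0 : (N.P0 : ℂ) ≠ 0 := by exact_mod_cast N.P0_pos.ne'
  have hA : ((N.A ^ (1 - N.ε) : ℝ) : ℂ) ≠ 0 := by
    exact_mod_cast (Real.rpow_pos_of_pos N.A_pos _).ne'
  have hr₀ : ((r₀ ^ (N.α * (N.ε - 1)) : ℝ) : ℂ) ≠ 0 := by
    exact_mod_cast (Real.rpow_pos_of_pos hr _).ne'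
  rw [signalAt, cuFactor]
  push_cast
  field_simp

lemma integrableOn_cuIntegrand {ν : Measure (ℝ × ℝ)} [IsProbabilityMeasure ν]
    (hν : N.IsServingLaw ν) {r₀ : ℝ} (hr : 0 < r₀) (w : ℝ) :
    IntegrableOn (N.cuIntegrand r₀ w) (Ioi N.cellRadius) := by
  have := Measure.isProbabilityMeasure_map (μ := ν) N.measurable_cuFactor.aemeasurable
  have hid : Integrable id (ν.map N.cuFactor) :=
    (integrable_map_measure (by fun_prop) (by fun_prop)).2 (N.integrable_cuFactor hν)
  rw [N.cuIntegrand_eq hν hr]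
  exact N.integrableOn_radialIntegrand hid _

instance isProbabilityMeasure_map_d2dFactor :
    IsProbabilityMeasure ((uniformOn (univ : Set Bool)).map N.d2dFactor) :=
  Measure.isProbabilityMeasure_map (by fun_prop)

lemma charFun_map_d2dFactor (v : ℝ) :
    charFun ((uniformOn (univ : Set Bool)).map N.d2dFactor) v =
      (1 + Complex.exp ((v * (N.Pd * N.A) : ℝ) * Complex.I)) / 2 := by
  have hcoin (b : Bool) : (uniformOn (univ : Set Bool)).real {b} = 1 / 2 := by
    rw [Measure.real, uniformOn_univ, Measure.count_singleton]
    simp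
  rw [charFun_apply_real, integral_map (by fun_prop) (by fun_prop),
    integral_fintype Integrable.of_finite, Fintype.sum_bool, hcoin, hcoin]
  simp only [d2dFactor, if_true, Bool.false_eq_true, if_false, Complex.ofReal_zero, mul_zero,
    zero_mul, Complex.exp_zero, Complex.real_smul]
  push_cast
  ring

lemma d2dIntegrand_eq {r₀ : ℝ} (hr : 0 < r₀) (w : ℝ) :
    N.d2dIntegrand r₀ w = fun τ =>
      2 * N.radialIntegrand ((uniformOn univ).map N.d2dFactor) (-(w / N.signalAt r₀)) τ := by
  ext τ
  have hP0 : (N.P0 : ℂ) ≠ 0 := by exact_mod_cast N.P0_pos.ne'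
  have hAε : ((N.A ^ N.ε : ℝ) : ℂ) ≠ 0 := by
    exact_mod_cast (Real.rpow_pos_of_pos N.A_pos _).ne'
  have hr₀ : ((r₀ ^ (N.α * (N.ε - 1)) : ℝ) : ℂ) ≠ 0 := by
    exact_mod_cast (Real.rpow_pos_of_pos hr _).ne'
  have hA : (N.A : ℂ) ≠ 0 := by exact_mod_cast N.A_pos.ne'
  have hexp : -(Complex.I * w * (N.A ^ N.ε * N.Pd : ℝ) / (N.P0 * r₀ ^ (N.α * (N.ε - 1)) : ℝ)
        * (τ ^ (-N.α) : ℝ))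
      = ((-(w / N.signalAt r₀) * τ ^ (-N.α) * (N.Pd * N.A) : ℝ) : ℂ) * Complex.I := by
    rw [signalAt, Real.rpow_sub N.A_pos, Real.rpow_one]
    push_cast
    field_simp
  rw [d2dIntegrand, radialIntegrand, charFun_map_d2dFactor, hexp]
  ring

lemma integrable_id_map_d2dFactor :
    Integrable id ((uniformOn (univ : Set Bool)).map N.d2dFactor) :=
  (integrable_map_measure (by fun_prop) (by fun_prop)).2 .of_finite

lemma integrableOn_d2dIntegrand {r₀ : ℝ} (hr : 0 < r₀) (w : ℝ) :
    IntegrableOn (N.d2dIntegrand r₀ w) (Ioi N.cellRadius) := by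
  rw [N.d2dIntegrand_eq hr]
  exact (N.integrableOn_radialIntegrand N.integrable_id_map_d2dFactor _).const_mul 2

lemma re_radialIntegrand_d2dFactor (u τ : ℝ) :
    (N.radialIntegrand ((uniformOn univ).map N.d2dFactor) u τ).re =
      2⁻¹ * ((1 - Real.cos (|u| * (N.Pd * N.A) * τ ^ (-N.α))) * τ) := by
  have hcos : Real.cos (|u| * (N.Pd * N.A) * τ ^ (-N.α))
      = Real.cos (u * τ ^ (-N.α) * (N.Pd * N.A)) := by
    rw [mul_right_comm]
    rcases abs_choice u with h | h <;> rw [h]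
    rw [neg_mul, neg_mul, Real.cos_neg]
  rw [radialIntegrand, charFun_map_d2dFactor, hcos, Complex.re_mul_ofReal, Complex.sub_re,
    Complex.div_ofNat_re, Complex.add_re, Complex.exp_ofReal_mul_I_re, Complex.one_re]
  ring

lemma le_re_integral_radialIntegrand_d2dFactor (u : ℝ) :
    (2 * Real.pi ^ 2 * (N.α - 1))⁻¹ * ((|u| * (N.Pd * N.A)) ^ (2 / N.α) - N.cellRadius ^ 2) ≤
      (∫ τ in Ioi N.cellRadius,
        N.radialIntegrand ((uniformOn univ).map N.d2dFactor) u τ).re := by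
  have hint := N.integrableOn_radialIntegrand N.integrable_id_map_d2dFactor u
  have hre := hint.re
  simp only [RCLike.re_eq_complex_re, re_radialIntegrand_d2dFactor] at hre
  rw [← RCLike.re_eq_complex_re, ← integral_re hint]
  simp only [RCLike.re_eq_complex_re, re_radialIntegrand_d2dFactor]
  rw [integral_const_mul, mul_assoc, mul_inv, mul_assoc]
  gcongr
  refine le_integral_one_sub_cos_mul (by linarith [N.two_lt_α]) N.cellRadius_pos
    (mul_nonneg (abs_nonneg u) (mul_pos N.Pd_pos N.A_pos).le) ?_
  simpa only [IntegrableOn, integrable_const_mul_iff (isUnit_iff_ne_zero.2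
    (inv_ne_zero (two_ne_zero' ℝ)))] using hre

lemma exists_norm_exp_integral_d2dFactor_le {c : ℝ} (hc : 0 < c) : ∃ C b : ℝ, 0 < b ∧ ∀ u : ℝ,
    ‖Complex.exp (-(c : ℂ) * ∫ τ in Ioi N.cellRadius,
        N.radialIntegrand ((uniformOn univ).map N.d2dFactor) u τ)‖
      ≤ C * Real.exp (-b * |u| ^ (2 / N.α)) := by
  have hα : 0 < N.α - 1 := by linarith [N.two_lt_α]
  have hPA : 0 < N.Pd * N.A := mul_pos N.Pd_pos N.A_pos
  set k := c * (2 * Real.pi ^ 2 * (N.α - 1))⁻¹ with hk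
  refine ⟨Real.exp (k * N.cellRadius ^ 2), k * (N.Pd * N.A) ^ (2 / N.α), by positivity,
    fun u => ?_⟩
  have hle := mul_le_mul_of_nonneg_left (N.le_re_integral_radialIntegrand_d2dFactor u) hc.le
  rw [Real.mul_rpow (abs_nonneg u) hPA.le, ← mul_assoc, ← hk] at hle
  rw [Complex.norm_exp, ← Real.exp_add, Real.exp_le_exp, ← Complex.ofReal_neg,
    Complex.re_ofReal_mul]
  linarith

end Exponents

end Network

lemma condExp_comp_ae_eq_of_indepFun {Ω β γ : Type*} [MeasurableSpace Ω] [mβ : MeasurableSpace β]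
    [MeasurableSpace γ] [StandardBorelSpace γ] [Nonempty γ] {P : Measure Ω} [IsFiniteMeasure P]
    {X : Ω → β} {Y : Ω → γ} (hX : Measurable X) (hY : Measurable Y) (hXY : IndepFun X Y P)
    {F : β × γ → ℂ} (hF : StronglyMeasurable F) (hi : Integrable (fun ω => F (X ω, Y ω)) P) :
    P[fun ω => F (X ω, Y ω) | mβ.comap X] =ᵐ[P] fun ω => ∫ y, F (X ω, y) ∂P.map Y := by
  have hcond : condDistrib Y X P =ᵐ[P.map X] Kernel.const β (P.map Y) := by
    refine condDistrib_ae_eq_of_measure_eq_compProd X hY.aemeasurable ?_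
    rw [Measure.compProd_const]
    exact (indepFun_iff_map_prod_eq_prod_map_map hX.aemeasurable hY.aemeasurable).1 hXY
  filter_upwards [condExp_prod_ae_eq_integral_condDistrib hX hY.aemeasurable hF hi,
    ae_of_ae_map hX.aemeasurable hcond] with ω hω hconst
  rw [hω, hconst, Kernel.const_apply]

lemma measureReal_preimage_prodMk_eq_integral_of_indepFun {Ω β γ : Type*} [MeasurableSpace Ω]
    [MeasurableSpace β] [MeasurableSpace γ] {P : Measure Ω} [IsFiniteMeasure P] {X : Ω → β}
    {Y : Ω → γ} (hX : Measurable X) (hY : Measurable Y) (hXY : IndepFun X Y P) {B : Set (β × γ)}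
    (hB : MeasurableSet B) :
    P.real {ω | (X ω, Y ω) ∈ B} = ∫ x, P.real {ω | (x, Y ω) ∈ B} ∂P.map X := by
  have hmap := (indepFun_iff_map_prod_eq_prod_map_map hX.aemeasurable hY.aemeasurable).1 hXY
  have hfiber (x : β) : P {ω | (x, Y ω) ∈ B} = P.map Y (Prod.mk x ⁻¹' B) :=
    (Measure.map_apply hY (measurable_prodMk_left hB)).symm
  simp only [measureReal_def, hfiber]
  rw [integral_toReal (measurable_measure_prodMk_left hB).aemeasurable
    (ae_of_all _ fun x => measure_lt_top _ _), ← Measure.prod_apply hB, ← hmap,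
    Measure.map_apply (hX.prodMk hY) hB]
  rfl

namespace Network

variable (N : Network)

/-- Interference and noise as a function of the configurations of interferers. -/
noncomputable def totalInterference
    (x : (ℕ → (Plane × ℝ) × (ℝ × ℝ)) × (ℕ → (Plane × ℝ) × Bool)) : ℝ≥0∞ :=
  shotNoise N.cuInterference x.1 + shotNoise N.d2dInterference x.2 + ENNReal.ofReal N.η

/-- Interference and noise at the typical base station as a real random variable: the denominator
of the SINR, with the junk value `0` on the null event that it is infinite. -/
noncomputable def disturbance {Ω : Type*} (Φc : ℕ → Ω → (Plane × ℝ) × (ℝ × ℝ))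
    (Φd : ℕ → Ω → (Plane × ℝ) × Bool) (ω : Ω) : ℝ :=
  (N.totalInterference (fun n => Φc n ω, fun n => Φd n ω)).toReal

/-- The conditional probability that the SINR exceeds `T` given that the equivalent serving
distance is `r`, expressed through the interference, which is independent of that distance. -/
noncomputable def coverageAt {Ω : Type*} [MeasurableSpace Ω]
    (Φc : ℕ → Ω → (Plane × ℝ) × (ℝ × ℝ)) (Φd : ℕ → Ω → (Plane × ℝ) × Bool) (P : Measure Ω)
    (T r : ℝ) : ℝ :=
  P.real {ω | N.disturbance Φc Φd ω / N.signalAt r < 1 / T}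

lemma charFun_shotNoise_of_ae_eq_response {Ω M : Type*} [MeasurableSpace Ω] [MeasurableSpace M]
    {P : Measure Ω} {c : ℝ} (hc : 0 ≤ c) {m : Measure M} [IsProbabilityMeasure m]
    {X : ℕ → Ω → (Plane × ℝ) × M} (hX : IsPoissonProcess X (N.markedIntensity c m) P)
    {a : M → ℝ} (ha : Measurable a) (hi : Integrable a m) (hnn : 0 ≤ᵐ[m] a)
    {f : (Plane × ℝ) × M → ℝ} (hf : Measurable f)
    (hfa : f =ᵐ[N.markedIntensity c m] N.response a) (u : ℝ) :
    charFun (P.map fun ω => (shotNoise f fun n => X n ω).toReal) u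
      = Complex.exp (-((2 * Real.pi * c * N.fadingScale : ℝ) : ℂ) *
        ∫ τ in Ioi N.cellRadius, N.radialIntegrand (m.map a) u τ) := by
  have hfnn : 0 ≤ᵐ[N.markedIntensity c m] f := by
    filter_upwards [hfa, Measure.quasiMeasurePreserving_snd.ae hnn] with p hp hap
    exact hp ▸ N.response_nonneg hap
  rw [hX.charFun_shotNoise hf ((N.integrable_response c m ha hi).congr hfa.symm) hfnn,
    ← N.integral_exp_response c m hc ha hi]
  congr 1
  exact integral_congr_ae (hfa.mono fun p hp => by simp only [hp])

@[fun_prop]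
lemma measurable_totalInterference : Measurable N.totalInterference := by
  unfold totalInterference
  fun_prop

section Uplink

variable {Ω : Type*} [MeasurableSpace Ω] {P : Measure Ω} {ν : Measure (ℝ × ℝ)} {q : ℝ}
  {L₀ : Ω → ℝ × ℝ} {Φc : ℕ → Ω → (Plane × ℝ) × (ℝ × ℝ)} {Φd : ℕ → Ω → (Plane × ℝ) × Bool}
  (hup : N.IsUplinkModel ν q L₀ Φc Φd P)
include hup

section Model

lemma measurable_disturbance : Measurable (N.disturbance Φc Φd) :=
  (N.measurable_totalInterference.comp
    (hup.poisson_cu.measurable_config.prodMk hup.poisson_d2d.measurable_config)).ennreal_toReal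

lemma measurable_servingEquivDist : Measurable (N.servingEquivDist L₀) :=
  N.measurable_equivDist.comp hup.measurable_link

lemma indepFun_servingEquivDist_disturbance :
    IndepFun (N.servingEquivDist L₀) (N.disturbance Φc Φd) P :=
  hup.indep_link.comp N.measurable_equivDist N.measurable_totalInterference.ennreal_toReal

variable (hν : N.IsServingLaw ν)
include hν

lemma map_servingEquivDist : P.map (N.servingEquivDist L₀) = N.servingDistLaw := by
  rw [← hν.map_equivDist, ← hup.law_link,
    Measure.map_map N.measurable_equivDist hup.measurable_link]
  rfl

lemma ae_link_pos : ∀ᵐ ω ∂P, 0 < (L₀ ω).1 ∧ 0 < (L₀ ω).2 :=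
  ae_of_ae_map hup.measurable_link.aemeasurable (hup.law_link ▸ hν.ae_pos)

variable [IsProbabilityMeasure ν]

lemma ae_shotNoise_cuInterference_ne_top :
    ∀ᵐ ω ∂P, shotNoise N.cuInterference (fun n => Φc n ω) ≠ ∞ :=
  IsPoissonProcess.ae_shotNoise_ne_top (Λ := N.markedIntensity N.lamB ν) hup.poisson_cu
    N.measurable_cuInterference ((N.integrable_response _ _ N.measurable_cuFactor
      (N.integrable_cuFactor hν)).congr (N.cuInterference_ae_eq_response hν _).symm)

omit [IsProbabilityMeasure ν] hν in
lemma ae_shotNoise_d2dInterference_ne_top :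
    ∀ᵐ ω ∂P, shotNoise N.d2dInterference (fun n => Φd n ω) ≠ ∞ :=
  IsPoissonProcess.ae_shotNoise_ne_top
    (Λ := N.markedIntensity ((1 - q) * N.lamU) (uniformOn (univ : Set Bool))) hup.poisson_d2d
    N.measurable_d2dInterference ((N.integrable_response _ _ .of_discrete .of_finite).congr
      (N.d2dInterference_ae_eq_response _).symm)

lemma ae_totalInterference_ne_top :
    ∀ᵐ ω ∂P, N.totalInterference (fun n => Φc n ω, fun n => Φd n ω) ≠ ∞ := by
  filter_upwards [N.ae_shotNoise_cuInterference_ne_top hup hν,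
    N.ae_shotNoise_d2dInterference_ne_top hup] with ω hc hd
  exact ENNReal.add_ne_top.2 ⟨ENNReal.add_ne_top.2 ⟨hc, hd⟩, ENNReal.ofReal_ne_top⟩

lemma disturbance_ae_eq : N.disturbance Φc Φd =ᵐ[P] fun ω =>
    (shotNoise N.cuInterference fun n => Φc n ω).toReal
      + (shotNoise N.d2dInterference fun n => Φd n ω).toReal + N.η := by
  filter_upwards [N.ae_shotNoise_cuInterference_ne_top hup hν,
    N.ae_shotNoise_d2dInterference_ne_top hup] with ω hc hd
  rw [disturbance, totalInterference, ENNReal.toReal_add (ENNReal.add_ne_top.2 ⟨hc, hd⟩)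
    ENNReal.ofReal_ne_top, ENNReal.toReal_add hc hd, ENNReal.toReal_ofReal N.η_nonneg]

lemma ae_inv_sinr : ∀ᵐ ω ∂P, (N.sinr L₀ Φc Φd ω)⁻¹ ≠ ∞ ∧ (N.sinr L₀ Φc Φd ω)⁻¹.toReal =
    N.disturbance Φc Φd ω / N.signalAt (N.servingEquivDist L₀ ω) := by
  filter_upwards [N.ae_totalInterference_ne_top hup hν, N.ae_link_pos hup hν] with ω hI hl
  have hS : 0 < N.signal (L₀ ω) := by
    rw [N.signal_eq hl]
    exact N.signalAt_pos (equivDist_pos hl.1 hl.2)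
  have hinv : (N.sinr L₀ Φc Φd ω)⁻¹ = N.totalInterference (fun n => Φc n ω, fun n => Φd n ω) /
      ENNReal.ofReal (N.signal (L₀ ω)) :=
    ENNReal.inv_div (.inr ENNReal.ofReal_ne_top) (.inr (ENNReal.ofReal_pos.2 hS).ne')
  rw [hinv]
  refine ⟨ENNReal.div_ne_top hI (ENNReal.ofReal_pos.2 hS).ne', ?_⟩
  rw [ENNReal.toReal_div, ENNReal.toReal_ofReal hS.le, N.signal_eq hl]
  rfl

end Model

section CharFun

lemma charFun_shotNoise_d2dInterference (hq : q < 1) (u : ℝ) :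
    charFun (P.map fun ω => (shotNoise N.d2dInterference fun n => Φd n ω).toReal) u
      = Complex.exp (-((2 * Real.pi * ((1 - q) * N.lamU) * N.fadingScale : ℝ) : ℂ) *
        ∫ τ in Ioi N.cellRadius, N.radialIntegrand ((uniformOn univ).map N.d2dFactor) u τ) :=
  N.charFun_shotNoise_of_ae_eq_response (mul_pos (sub_pos.2 hq) N.lamU_pos).le hup.poisson_d2d
    .of_discrete .of_finite (ae_of_all _ N.d2dFactor_nonneg) N.measurable_d2dInterference
    (N.d2dInterference_ae_eq_response _) u

variable (hν : N.IsServingLaw ν) [IsProbabilityMeasure ν]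
include hν

lemma charFun_shotNoise_cuInterference (u : ℝ) :
    charFun (P.map fun ω => (shotNoise N.cuInterference fun n => Φc n ω).toReal) u
      = Complex.exp (-((2 * Real.pi * N.lamB * N.fadingScale : ℝ) : ℂ) *
        ∫ τ in Ioi N.cellRadius, N.radialIntegrand (ν.map N.cuFactor) u τ) :=
  N.charFun_shotNoise_of_ae_eq_response N.lamB_pos.le hup.poisson_cu N.measurable_cuFactor
    (N.integrable_cuFactor hν) (hν.ae_pos.mono fun _ => N.cuFactor_nonneg)
    N.measurable_cuInterference (N.cuInterference_ae_eq_response hν _) u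

lemma charFun_disturbance (u : ℝ) :
    charFun (P.map (N.disturbance Φc Φd)) u =
      charFun (P.map fun ω => (shotNoise N.cuInterference fun n => Φc n ω).toReal) u *
      charFun (P.map fun ω => (shotNoise N.d2dInterference fun n => Φd n ω).toReal) u *
      Complex.exp (N.η * u * Complex.I) := by
  have := hup.poisson_cu.isProbabilityMeasure
  have hmc : Measurable fun x => (shotNoise N.cuInterference x).toReal := by fun_prop
  have hmd : Measurable fun x => (shotNoise N.d2dInterference x).toReal := by fun_prop
  have hXc : Measurable fun ω => (shotNoise N.cuInterference fun n => Φc n ω).toReal :=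
    hmc.comp hup.poisson_cu.measurable_config
  have hXd : Measurable fun ω => (shotNoise N.d2dInterference fun n => Φd n ω).toReal :=
    hmd.comp hup.poisson_d2d.measurable_config
  have hadd := congrFun ((hup.indep_cu_d2d.comp hmc hmd).charFun_map_add_eq_mul
    hXc.aemeasurable hXd.aemeasurable) u
  have hconst := charFun_map_add_const (μ := P.map fun ω =>
    (shotNoise N.cuInterference fun n => Φc n ω).toReal
      + (shotNoise N.d2dInterference fun n => Φd n ω).toReal) N.η u
  rw [Measure.map_map (by fun_prop) (by fun_prop)] at hconst
  rw [Measure.map_congr (N.disturbance_ae_eq hup hν)]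
  exact hconst.trans (congrArg₂ (· * ·) hadd (by simp [mul_comm]))

lemma condCharFun_eq_charFun_disturbance (hq : q < 1) {r₀ : ℝ} (hr : 0 < r₀) (w : ℝ) :
    N.condCharFun q r₀ w = charFun (P.map (N.disturbance Φc Φd)) (-(w / N.signalAt r₀)) := by
  rw [N.charFun_disturbance hup hν, N.charFun_shotNoise_cuInterference hup hν,
    N.charFun_shotNoise_d2dInterference hup hq, condCharFun, N.cuIntegrand_eq hν hr,
    N.d2dIntegrand_eq hr, integral_const_mul]
  congr 2
  · rw [fadingScale]
    push_cast
    ring_nf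
  · have hP0 : (N.P0 : ℂ) ≠ 0 := by exact_mod_cast N.P0_pos.ne'
    have hAε : ((N.A ^ N.ε : ℝ) : ℂ) ≠ 0 := by
      exact_mod_cast (Real.rpow_pos_of_pos N.A_pos _).ne'
    have hr₀ : ((r₀ ^ (N.α * (N.ε - 1)) : ℝ) : ℂ) ≠ 0 := by
      exact_mod_cast (Real.rpow_pos_of_pos hr _).ne'
    have hA : (N.A : ℂ) ≠ 0 := by exact_mod_cast N.A_pos.ne'
    rw [signalAt, Real.rpow_sub N.A_pos, Real.rpow_sub N.A_pos, Real.rpow_one]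
    push_cast
    field_simp

lemma integrable_charFun_disturbance (hq : q < 1) :
    Integrable (charFun (P.map (N.disturbance Φc Φd))) := by
  have := hup.poisson_cu.isProbabilityMeasure
  have hc : 0 < 2 * Real.pi * ((1 - q) * N.lamU) * N.fadingScale :=
    mul_pos (mul_pos Real.two_pi_pos (mul_pos (sub_pos.2 hq) N.lamU_pos)) N.fadingScale_pos
  obtain ⟨C, b, hb, hle⟩ := N.exists_norm_exp_integral_d2dFactor_le hc
  have hα : 0 < 2 / N.α := div_pos two_pos N.α_pos
  refine ((integrable_exp_neg_mul_abs_rpow hα hb).const_mul C).mono'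
    measurable_charFun.aestronglyMeasurable (ae_of_all _ fun u => ?_)
  have hnoise : ‖Complex.exp (N.η * u * Complex.I)‖ = 1 := by
    rw [← Complex.ofReal_mul, Complex.norm_exp_ofReal_mul_I]
  have hcu : ‖charFun (P.map fun ω => (shotNoise N.cuInterference fun n => Φc n ω).toReal) u‖
      ≤ 1 := by
    have hm : Measurable fun ω => (shotNoise N.cuInterference fun n => Φc n ω).toReal :=
      (measurable_shotNoise N.measurable_cuInterference).ennreal_toReal.comp
        hup.poisson_cu.measurable_config
    have := Measure.isProbabilityMeasure_map (μ := P) hm.aemeasurable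
    exact norm_charFun_le_one u
  rw [N.charFun_disturbance hup hν, norm_mul, norm_mul, hnoise, mul_one,
    N.charFun_shotNoise_d2dInterference hup hq]
  exact (mul_le_of_le_one_left (norm_nonneg _) hcu).trans (hle u)

lemma integrable_condCharFun (hq : q < 1) {r₀ : ℝ} (hr : 0 < r₀) :
    Integrable (N.condCharFun q r₀) := by
  rw [funext (N.condCharFun_eq_charFun_disturbance hup hν hq hr)]
  exact ((N.integrable_charFun_disturbance hup hν hq).comp_neg).comp_div (N.signalAt_pos hr).ne'

end CharFun

section Coverage

variable (hν : N.IsServingLaw ν) [IsProbabilityMeasure ν] (hq : q < 1)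
include hν hq

theorem condExp_exp_inv_sinr (w : ℝ) :
    P[fun ω => Complex.exp (-(Complex.I * w * (((N.sinr L₀ Φc Φd ω)⁻¹).toReal : ℂ))) |
        MeasurableSpace.comap (N.servingEquivDist L₀) inferInstance]
      =ᵐ[P] fun ω => N.condCharFun q (N.servingEquivDist L₀ ω) w := by
  have := hup.poisson_cu.isProbabilityMeasure
  have hmZ := N.measurable_disturbance hup
  have hmR := N.measurable_servingEquivDist hup
  set F : ℝ × ℝ → ℂ := fun p => Complex.exp ((-(w / N.signalAt p.1) : ℝ) * p.2 * Complex.I)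
  have hF : Measurable F := by fun_prop
  have hsinr : (fun ω => Complex.exp (-(Complex.I * w * (((N.sinr L₀ Φc Φd ω)⁻¹).toReal : ℂ))))
      =ᵐ[P] fun ω => F (N.servingEquivDist L₀ ω, N.disturbance Φc Φd ω) := by
    filter_upwards [N.ae_inv_sinr hup hν] with ω hω
    rw [hω.2]
    simp only [F]
    push_cast
    ring_nf
  have hint : Integrable (fun ω => F (N.servingEquivDist L₀ ω, N.disturbance Φc Φd ω)) P := by
    refine Integrable.of_bound (hF.comp (hmR.prodMk hmZ)).aestronglyMeasurable 1
      (ae_of_all _ fun ω => ?_)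
    simp only [F]
    rw [← Complex.ofReal_mul, Complex.norm_exp_ofReal_mul_I]
  filter_upwards [condExp_congr_ae hsinr, condExp_comp_ae_eq_of_indepFun hmR hmZ
    (N.indepFun_servingEquivDist_disturbance hup) hF.stronglyMeasurable hint,
    N.ae_link_pos hup hν] with ω hω hcond hl
  have hr : 0 < N.servingEquivDist L₀ ω := equivDist_pos hl.1 hl.2
  rw [hω, hcond, N.condCharFun_eq_charFun_disturbance hup hν hq hr,
    charFun_apply_real]

lemma integral_inversionKernel_condCharFun {T : ℝ} (hT : 0 < T) {r : ℝ} (hr : 0 < r) :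
    ∫ w : ℝ, inversionKernel T w * N.condCharFun q r w = N.coverageAt Φc Φd P T r := by
  have := hup.poisson_cu.isProbabilityMeasure
  have hmZ := N.measurable_disturbance hup
  have hS := N.signalAt_pos hr
  set μ := P.map fun ω => (N.signalAt r)⁻¹ * N.disturbance Φc Φd ω with hμ
  have hm : Measurable fun ω => (N.signalAt r)⁻¹ * N.disturbance Φc Φd ω := hmZ.const_mul _
  have := Measure.isProbabilityMeasure_map (μ := P) hm.aemeasurable
  have hφ : charFun μ = fun v => N.condCharFun q r (-v) := by
    ext v
    rw [N.condCharFun_eq_charFun_disturbance hup hν hq hr,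
      charFun_map_mul_comp hmZ.aemeasurable, neg_div, neg_neg, inv_mul_eq_div]
  have hneg : μ (Iio 0) = 0 := by
    rw [hμ, Measure.map_apply hm measurableSet_Iio]
    convert measure_empty (μ := P)
    exact eq_empty_of_forall_notMem fun ω hω =>
      not_lt.2 (mul_nonneg (inv_nonneg.2 hS.le) ENNReal.toReal_nonneg) hω
  have hinv := measureReal_Iio_eq_integral_inversionKernel hneg
    (hφ ▸ (N.integrable_condCharFun hup hν hq hr).comp_neg) hT
  simp only [hφ, neg_neg] at hinv
  rw [← hinv, hμ, map_measureReal_apply hm measurableSet_Iio]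
  simp only [coverageAt, div_eq_inv_mul]
  rfl

omit hν hq [IsProbabilityMeasure ν] in
lemma measurable_coverageAt (T : ℝ) : Measurable (N.coverageAt Φc Φd P T) := by
  have := hup.poisson_cu.isProbabilityMeasure
  have hmZ := N.measurable_disturbance hup
  have hset : MeasurableSet {p : ℝ × Ω | N.disturbance Φc Φd p.2 / N.signalAt p.1 < 1 / T} :=
    measurableSet_lt (by fun_prop) measurable_const
  exact (measurable_measure_prodMk_left (ν := P) hset).ennreal_toReal

omit hq in
lemma measureReal_lt_sinr {T : ℝ} (hT : 0 < T) :
    P.real {ω | ENNReal.ofReal T < N.sinr L₀ Φc Φd ω} =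
      ∫ r, N.coverageAt Φc Φd P T r ∂N.servingDistLaw := by
  have := hup.poisson_cu.isProbabilityMeasure
  set B : Set (ℝ × ℝ) := {p | p.2 / N.signalAt p.1 < 1 / T}
  have hB : MeasurableSet B := measurableSet_lt (by fun_prop) measurable_const
  have hcov := measureReal_preimage_prodMk_eq_integral_of_indepFun
    (N.measurable_servingEquivDist hup) (N.measurable_disturbance hup)
    (N.indepFun_servingEquivDist_disturbance hup) hB
  rw [N.map_servingEquivDist hup hν] at hcov
  refine (measureReal_congr ?_).trans hcov
  filter_upwards [N.ae_inv_sinr hup hν] with ω hω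
  refine propext ?_
  change ENNReal.ofReal T < N.sinr L₀ Φc Φd ω ↔
    N.disturbance Φc Φd ω / N.signalAt (N.servingEquivDist L₀ ω) < 1 / T
  rw [← hω.2, ← ENNReal.inv_lt_inv, ← ENNReal.ofReal_inv_of_pos hT, one_div,
    ENNReal.lt_ofReal_iff_toReal_lt hω.1]

theorem intervalIntegrable_integral_inversionKernel {T : ℝ} (hT : 0 < T) :
    IntervalIntegrable (fun r : ℝ => (∫ w : ℝ, inversionKernel T w * N.condCharFun q r w)
      * (N.servingPdf r : ℂ)) volume 0 N.cellRadius := by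
  have := hup.poisson_cu.isProbabilityMeasure
  have hcov : Measurable fun r => (N.coverageAt Φc Φd P T r : ℂ) :=
    Complex.measurable_ofReal.comp (N.measurable_coverageAt hup T)
  have hpdf : IntegrableOn (fun r => (N.servingPdf r : ℂ)) (Ioc 0 N.cellRadius) :=
    (Complex.continuous_ofReal.comp N.continuous_servingPdf).integrableOn_Ioc
  rw [intervalIntegrable_iff_integrableOn_Ioc_of_le N.cellRadius_pos.le]
  refine IntegrableOn.congr_fun (hpdf.bdd_mul (c := 1) hcov.aestronglyMeasurable
    (ae_of_all _ fun r => ?_)) (fun r hr => ?_) measurableSet_Ioc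
  · rw [Complex.norm_real, coverageAt, Real.norm_of_nonneg measureReal_nonneg]
    exact measureReal_le_one
  · simp only [N.integral_inversionKernel_condCharFun hup hν hq hT hr.1]

theorem measureReal_lt_sinr_eq_integral_inversionKernel {T : ℝ} (hT : 0 < T) :
    ((P.real {ω | ENNReal.ofReal T < N.sinr L₀ Φc Φd ω} : ℝ) : ℂ) =
      ∫ r in (0 : ℝ)..N.cellRadius,
        (∫ w : ℝ, inversionKernel T w * N.condCharFun q r w) * (N.servingPdf r : ℂ) := by
  rw [N.measureReal_lt_sinr hup hν hT, ← integral_complex_ofReal, ← N.integral_servingDistLaw]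
  refine integral_congr_ae ?_
  filter_upwards [N.ae_servingDistLaw_mem] with r hr
  exact (N.integral_inversionKernel_condCharFun hup hν hq hT hr.1).symm

end Coverage

end Uplink

end Network

theorem lemma4 (N : Network)
    {Ω₀ Ω : Type*} [MeasurableSpace Ω₀] [MeasurableSpace Ω]
    (P₀ : Measure Ω₀) [IsProbabilityMeasure P₀] (P : Measure Ω) [IsProbabilityMeasure P]
    (Φb : ℕ → Ω₀ → Plane × ℝ) (hb : IsPoissonProcess Φb N.bsIntensity P₀)
    (L₀ : Ω → ℝ × ℝ) (Φc : ℕ → Ω → (Plane × ℝ) × (ℝ × ℝ)) (Φd : ℕ → Ω → (Plane × ℝ) × Bool)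
    (hup : N.IsUplinkModel (N.servingLaw Φb P₀) (N.cellularProb Φb P₀) L₀ Φc Φd P)
    (T : ℝ) (hT : 0 < T) :
    -- the equivalent serving distance has density `servingPdf` on `(0, t]`
    P.map (N.servingEquivDist L₀) =
      (volume.restrict (Ioc 0 N.cellRadius)).withDensity
        (fun r => ENNReal.ofReal (N.servingPdf r)) ∧
    -- the integrals in the exponents converge
    (∀ r₀ ∈ Ioc 0 N.cellRadius, ∀ w : ℝ,
      IntegrableOn (N.cuIntegrand r₀ w) (Ioi N.cellRadius) ∧
      IntegrableOn (N.d2dIntegrand r₀ w) (Ioi N.cellRadius)) ∧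
    -- `condCharFun` is the conditional characteristic function of `1 / SINR`
    (∀ᵐ ω ∂P, (N.sinr L₀ Φc Φd ω)⁻¹ ≠ ∞) ∧
    (∀ w : ℝ,
      P[fun ω => Complex.exp (-(Complex.I * w * (((N.sinr L₀ Φc Φd ω)⁻¹).toReal : ℂ))) |
          MeasurableSpace.comap (N.servingEquivDist L₀) inferInstance]
        =ᵐ[P] fun ω => N.condCharFun (N.cellularProb Φb P₀) (N.servingEquivDist L₀ ω) w) ∧
    -- the coverage probability
    (∀ r₀ ∈ Ioc 0 N.cellRadius,
      Integrable (fun w : ℝ => inversionKernel T w *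
        N.condCharFun (N.cellularProb Φb P₀) r₀ w)) ∧
    IntervalIntegrable (fun r : ℝ =>
      (∫ w : ℝ, inversionKernel T w * N.condCharFun (N.cellularProb Φb P₀) r w)
        * (N.servingPdf r : ℂ)) volume 0 N.cellRadius ∧
    ((P.real {ω | ENNReal.ofReal T < N.sinr L₀ Φc Φd ω} : ℝ) : ℂ) =
      ∫ r in (0 : ℝ)..N.cellRadius,
        (∫ w : ℝ, inversionKernel T w * N.condCharFun (N.cellularProb Φb P₀) r w)
          * (N.servingPdf r : ℂ) := by
  have hν := N.isServingLaw_servingLaw hb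
  have hq := Network.cellularProb_lt_one hb
  have : IsProbabilityMeasure (N.servingLaw Φb P₀) :=
    hup.law_link ▸ Measure.isProbabilityMeasure_map hup.measurable_link.aemeasurable
  exact ⟨N.map_servingEquivDist hup hν,
    fun r₀ hr w => ⟨N.integrableOn_cuIntegrand hν hr.1 w, N.integrableOn_d2dIntegrand hr.1 w⟩,
    (N.ae_inv_sinr hup hν).mono fun _ hω => hω.1,
    N.condExp_exp_inv_sinr hup hν hq,
    fun r₀ hr => integrable_inversionKernel_mul (N.integrable_condCharFun hup hν hq hr.1) hT,
    N.intervalIntegrable_integral_inversionKernel hup hν hq hT,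
    N.measureReal_lt_sinr_eq_integral_inversionKernel hup hν hq hT⟩
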